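/- All Hamiltonians are Hermitian operators on finitely many qubits, presented as a sum of terms. A Hamiltonian is $k$-local if each term acts non-trivially on at most $k$ qubits; stoquastic if each term has real non-positive off-diagonal entries in the computational basis; and frustration free if its ground states are simultaneously ground states of each term (SFF = stoquastic and frustration free). The distribution of a unit vector $|\psi\rangle$ is $x\mapsto|\langle x|\psi\rangle|^2$. There is an absolute constant $C>0$ such that the following holds. Let $H=\sum_{a=1}^L H_a$ be a $k$-local stoquastic Hamiltonian on $n$ qubits with $L$ terms, with operator norms $\|H_a\|\le J$ for every $a$, and with energy gap $\Delta$ (the difference between the two smallest distinct eigenvalues of $H$, which is assumed to have at least two). Let $|+\rangle=2^{-n/2}\sum_{x\in\{0,1\}^n}|x\rangle$, let $\Pi$ be the orthogonal projection onto the ground subspace of $H$, let $\eta=\sqrt{\langle +|\Pi|+\rangle}$, assume $\eta>0$, and let $|\psi_0\rangle=\frac1\eta\Pi|+\rangle$. Let $0<\epsilon\le\frac12$ and put $$B = k\,\eta^{-1/2}L^{5/2}J^{3/2}\Delta^{-3/2}\epsilon^{-1/2}\bigl(\log(\eta^{-1}\epsilon^{-1})\bigr)^{3/2}.$$ Then there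 are an integer $m\ge 0$ and a $4k$-local SFF Hamiltonian $H'$ on $n+m$ qubits, with exactly one term for each qubit (that is, $n+m$ terms indexed by the qubits, the term of each qubit acting non-trivially on it), such that $H'$ has a unique ground state up to phase, and the marginal on the first $n$ bits of the distribution of this ground state is within total variation distance $\epsilon$ of the distribution of $|\psi_0\rangle$. The number of additional qubits satisfies $m\le C\,B$; and if $n\le kL$ (in particular, if every qubit is acted on non-trivially by some term of $H$), the total number of qubits satisfies $n+m\le C\,B$. -/

import Mathlib

noncomputable section

namespace Stoq

/-- Computational basis labels of `n` qubits. -/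
abbrev Bits (n : ℕ) : Type := Fin n → Bool

/-- Operators on `n` qubits, as matrices in the computational basis. -/
abbrev Operator (n : ℕ) : Type := Matrix (Bits n) (Bits n) ℂ

/-- The Hilbert space of `n` qubits. -/
abbrev StateSpace (n : ℕ) : Type := EuclideanSpace ℂ (Bits n)

/-- `A` acts non-trivially only on the qubits in `S`: it is `B ⊗ 1`, with `B` an operator on the
qubits in `S` and `1` the identity on the remaining qubits. -/
def ActsOn {n : ℕ} (A : Operator n) (S : Finset (Fin n)) : Prop :=
  ∃ B : Matrix (S → Bool) (S → Bool) ℂ, ∀ x y : Bits n,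
    A x y = if ∀ i, i ∉ S → x i = y i then B (fun i => x i) (fun i => y i) else 0

/-- A `k`-local Hamiltonian on `n` qubits, presented as a sum of `L` terms. -/
structure LocalHamiltonian (n L k : ℕ) where
  /-- The individual terms. -/
  term : Fin L → Operator n
  isHermitian : ∀ a, (term a).IsHermitian
  isLocal : ∀ a, ∃ S : Finset (Fin n), S.card ≤ k ∧ ActsOn (term a) S

/-- The total Hamiltonian, i.e. the sum of its terms. -/
def LocalHamiltonian.total {n L k : ℕ} (H : LocalHamiltonian n L k) : Operator n :=
  ∑ a, H.term a

/-- Every term has real non-positive off-diagonal entries in the computational basis. -/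
def LocalHamiltonian.IsStoquastic {n L k : ℕ} (H : LocalHamiltonian n L k) : Prop :=
  ∀ a x y, x ≠ y → (H.term a x y).im = 0 ∧ (H.term a x y).re ≤ 0

/-- The energies (eigenvalues) of an operator. -/
def energies {n : ℕ} (A : Operator n) : Set ℝ :=
  {e : ℝ | Module.End.HasEigenvalue (Matrix.toEuclideanLin A) (e : ℂ)}

/-- The ground energy: the least eigenvalue (see `isLeast_groundEnergy`). -/
def groundEnergy {n : ℕ} (A : Operator n) : ℝ := sInf (energies A)

/-- The ground subspace: the eigenspace of the ground energy. -/
def groundSpace {n : ℕ} (A : Operator n) : Submodule ℂ (StateSpace n) :=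
  Module.End.eigenspace (Matrix.toEuclideanLin A) (groundEnergy A : ℂ)

/-- `Δ` is the energy gap of `A`: the least energy different from the ground energy `E` is
`E + Δ`. -/
def IsEnergyGap {n : ℕ} (A : Operator n) (Δ : ℝ) : Prop :=
  IsLeast (energies A \ {groundEnergy A}) (groundEnergy A + Δ)

/-- The ground states of the total Hamiltonian are ground states of every term. -/
def LocalHamiltonian.IsFrustrationFree {n L k : ℕ} (H : LocalHamiltonian n L k) : Prop :=
  ∀ a, groundSpace H.total ≤ groundSpace (H.term a)

/-- The operator norm, with respect to the Hilbert space norm. -/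
def opNorm {n : ℕ} (A : Operator n) : ℝ := ‖Matrix.toEuclideanCLM (𝕜 := ℂ) A‖

/-- The uniform superposition state `|+⟩`. -/
def plus (n : ℕ) : StateSpace n := WithLp.toLp 2 (fun _ => ((1 / √((2 : ℝ) ^ n) : ℝ) : ℂ))

/-- The orthogonal projection onto the ground subspace. -/
def groundProj {n : ℕ} (A : Operator n) : StateSpace n →L[ℂ] StateSpace n :=
  (groundSpace A).starProjection

/-- The overlap `η = √⟨+|Π|+⟩`. -/
def overlap {n : ℕ} (A : Operator n) : ℝ :=
  √(inner ℂ (plus n) (groundProj A (plus n))).re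

/-- The ground state `|ψ₀⟩ = η⁻¹ Π |+⟩`. -/
def groundState {n : ℕ} (A : Operator n) : StateSpace n :=
  (((overlap A)⁻¹ : ℝ) : ℂ) • groundProj A (plus n)

/-- The distribution `x ↦ |⟨x|ψ⟩|²` of a state. -/
def distribution {n : ℕ} (ψ : StateSpace n) (x : Bits n) : ℝ := ‖ψ x‖ ^ 2

/-- The marginal on the first `n` bits of a distribution on `n + m` bits. -/
def marginal {n m : ℕ} (p : Bits (n + m) → ℝ) (x : Bits n) : ℝ :=
  ∑ h : Bits m, p (Fin.append x h)

/-- Total variation distance. -/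
def tvDist {n : ℕ} (p q : Bits n → ℝ) : ℝ := (1 / 2) * ∑ x, |p x - q x|

/-- The expression `k η^{-1/2} L^{5/2} J^{3/2} Δ^{-3/2} ε^{-1/2} (log (η⁻¹ ε⁻¹))^{3/2}`. -/
def qubitBound (k L : ℕ) (J Δ η ε : ℝ) : ℝ :=
  (k : ℝ) * η ^ (-(1 / 2) : ℝ) * (L : ℝ) ^ (5 / 2 : ℝ) * J ^ (3 / 2 : ℝ) * Δ ^ (-(3 / 2) : ℝ) *
    ε ^ (-(1 / 2) : ℝ) * Real.log (η⁻¹ * ε⁻¹) ^ (3 / 2 : ℝ)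

theorem finite_energies {n : ℕ} (A : Operator n) : (energies A).Finite := by
  have h := Module.End.finite_hasEigenvalue (Matrix.toEuclideanLin A)
  exact h.preimage (f := fun e : ℝ => (e : ℂ)) (Complex.ofReal_injective.injOn)

theorem isLeast_groundEnergy {n : ℕ} {A : Operator n} (hA : A.IsHermitian) :
    IsLeast (energies A) (groundEnergy A) := by
  have hne : (energies A).Nonempty := by
    refine ⟨hA.eigenvalues (fun _ => false), ?_⟩
    refine Module.End.hasEigenvalue_of_hasEigenvector
      (x := hA.eigenvectorBasis (fun _ => false)) ⟨?_, ?_⟩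
    · rw [Module.End.mem_eigenspace_iff]
      ext x
      have := congrFun (hA.mulVec_eigenvectorBasis (fun _ => false)) x
      simpa [Matrix.toLpLin_apply] using this
    · exact hA.eigenvectorBasis.orthonormal.ne_zero _
  exact ⟨hne.csInf_mem (finite_energies A),
    fun e he => csInf_le (finite_energies A).bddBelow he⟩

end Stoq

end

noncomputable section

namespace Stoq

open scoped ComplexOrder

/-! Imaginary-time evolution under `H` projects `|+⟩` onto the ground space, and for stoquastic `H`
a Trotter product of nonnegative `k`-local gates simulates it. The output amplitude `f x` is then a
sum over histories (hidden bits) of products of local nonnegative weights. Its square is such a sum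
over two independent histories sharing the visible bits `x`, so `f ^ 2`, normalized, is a marginal
of a locally factorizing distribution. Conversely, if `W > 0` and each ratio `W (flip j z) / W z`
depends on few bits, then `√W` is the unique common null vector of local stoquastic projectors, one
per qubit (`exists_parentHamiltonian`). Each gate adds at most `k` hidden bits. The factor `4` in
the locality arises because a hidden bit links two gates of one copy, and a visible bit enters one
gate of each copy (`exists_network`, `exists_hamiltonian_of_gates`). The qubit count rests on
second-order accuracy. A palindromic product of quadratic Taylor polynomials, with total norm `σ`
per step, has error `σ ^ 3` (`secondOrder_palindrome`). With `r` steps, the choice `r * τ * Δ = 10 *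
log (1 / (η * ε))` filters out excited states, and the accumulated error is of order `y ^ 3 / r ^
2`, where `y = r * σ` is of order `(L * J / Δ) * log (1 / (η * ε))`. Accuracy `η * ε` thus needs `r`
of order `y ^ (3 / 2) * (η * ε) ^ (-1 / 2)` (`norm_palindrome_pow_sub_groundProj_le`,
`exists_numSteps`). Division by `η` on normalizing turns this into an error `ε`. Strict positivity
of the gates comes from a small perturbation (`exists_shift_tvDist_le`). -/

/-! ### Bit flips and flip ratios of a positive weight. -/

/-- Flip the bit at position `v`. -/
def flip {V : Type*} [DecidableEq V] (v : V) (z : V → Bool) : V → Bool :=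
  Function.update z v (!z v)

@[simp] theorem flip_same {V : Type*} [DecidableEq V] (v : V) (z : V → Bool) :
    flip v z v = !z v := by simp [flip]

theorem flip_of_ne {V : Type*} [DecidableEq V] {v u : V} (h : u ≠ v) (z : V → Bool) :
    flip v z u = z u := by simp [flip, h]

@[simp] theorem flip_flip {V : Type*} [DecidableEq V] (v : V) (z : V → Bool) :
    flip v (flip v z) = z := by
  ext u
  by_cases h : u = v
  · subst h; simp
  · simp [flip_of_ne h]

theorem flip_ne {V : Type*} [DecidableEq V] (v : V) (z : V → Bool) : flip v z ≠ z := by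
  intro h
  have := congrFun h v
  simp at this

/-- The factor by which the weight `W` changes when the bit at `v` is flipped. -/
def flipRatio {V : Type*} [DecidableEq V] (W : (V → Bool) → ℝ) (v : V) (z : V → Bool) : ℝ :=
  W (flip v z) / W z

theorem flipRatio_pos {V : Type*} [DecidableEq V] {W : (V → Bool) → ℝ} (hW : ∀ z, 0 < W z)
    (v : V) (z : V → Bool) : 0 < flipRatio W v z := div_pos (hW _) (hW _)

theorem flipRatio_flip {V : Type*} [DecidableEq V] (W : (V → Bool) → ℝ)
    (v : V) (z : V → Bool) : flipRatio W v (flip v z) = (flipRatio W v z)⁻¹ := by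
  simp [flipRatio]

/-- `S` contains `v`, and the flip ratio of `W` at `v` depends only on the bits in `S`. -/
def IsBlanket {V : Type*} [DecidableEq V] (W : (V → Bool) → ℝ) (v : V) (S : Finset V) : Prop :=
  v ∈ S ∧ ∀ z z', (∀ u ∈ S, z u = z' u) → flipRatio W v z = flipRatio W v z'

/-- The heat-bath projector of the weight `W` at the qubit `j`. -/
def heatBath {N : ℕ} (W : Bits N → ℝ) (j : Fin N) : Operator N := fun x y =>
  if x = y then ((flipRatio W j x / (1 + flipRatio W j x) : ℝ) : ℂ)
  else if y = flip j x then ((-(√(flipRatio W j x) / (1 + flipRatio W j x)) : ℝ) : ℂ) else 0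

/-! ### Heat-bath projectors. -/

section HeatBath

variable {N : ℕ} {W : Bits N → ℝ}

theorem heatBath_isHermitian (hW : ∀ z, 0 < W z) (j : Fin N) : (heatBath W j).IsHermitian := by
  ext x y
  rw [Matrix.conjTranspose_apply]
  unfold heatBath
  by_cases h : x = y
  · subst h
    rw [if_pos rfl, Complex.star_def, Complex.conj_ofReal]
  · rw [if_neg (Ne.symm h), if_neg h]
    by_cases h2 : y = flip j x
    · have h3 : x = flip j y := by rw [h2, flip_flip]
      rw [if_pos h2, if_pos h3, Complex.star_def, Complex.conj_ofReal, h2, flipRatio_flip]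
      have hq := flipRatio_pos hW j x
      congr 2
      rw [Real.sqrt_inv]
      have h4 : √(flipRatio W j x) * √(flipRatio W j x) = flipRatio W j x :=
        Real.mul_self_sqrt hq.le
      have h5 : 0 < √(flipRatio W j x) := Real.sqrt_pos.2 hq
      field_simp
      rw [pow_two, h4, add_comm]
    · have h3 : x ≠ flip j y := fun h3 => h2 (by rw [h3, flip_flip])
      rw [if_neg h2, if_neg h3, star_zero]

theorem heatBath_mulVec (j : Fin N) (ψ : Bits N → ℂ) (x : Bits N) :
    (heatBath W j).mulVec ψ x =
      ((flipRatio W j x / (1 + flipRatio W j x) : ℝ) : ℂ) * ψ x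
        - ((√(flipRatio W j x) / (1 + flipRatio W j x) : ℝ) : ℂ) * ψ (flip j x) := by
  rw [Matrix.mulVec, dotProduct]
  have h : ∀ y, heatBath W j x y * ψ y =
      (if x = y then ((flipRatio W j x / (1 + flipRatio W j x) : ℝ) : ℂ) * ψ y else 0) +
      (if flip j x = y then
        ((-(√(flipRatio W j x) / (1 + flipRatio W j x)) : ℝ) : ℂ) * ψ y else 0) := by
    intro y
    unfold heatBath
    by_cases h : x = y
    · subst h
      simp [flip_ne]
    · rw [if_neg h, if_neg h]
      by_cases h2 : y = flip j x
      · simp [h2]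
      · simp [h2, Ne.symm h2]
  rw [Finset.sum_congr rfl fun y _ => h y, Finset.sum_add_distrib]
  simp [sub_eq_add_neg]

/-- The heat-bath projector annihilates a vector exactly if its amplitudes have the ratio of the
square roots of the weights. -/
theorem heatBath_mulVec_eq_zero (hW : ∀ z, 0 < W z) (j : Fin N) (ψ : Bits N → ℂ) :
    (heatBath W j).mulVec ψ = 0 ↔
      ∀ x, ψ (flip j x) / ((√(W (flip j x)) : ℝ) : ℂ) = ψ x / ((√(W x) : ℝ) : ℂ) := by
  rw [funext_iff]
  refine forall_congr' fun x => ?_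
  rw [heatBath_mulVec, Pi.zero_apply]
  have hq := flipRatio_pos hW j x
  have e1 : flipRatio W j x / (1 + flipRatio W j x) =
      √(W (flip j x)) * (√(W (flip j x)) / (W x + W (flip j x))) := by
    have := hW x
    have := hW (flip j x)
    rw [← mul_div_assoc, Real.mul_self_sqrt (hW _).le, flipRatio]
    field_simp
  have e2 : √(flipRatio W j x) / (1 + flipRatio W j x) =
      √(W x) * (√(W (flip j x)) / (W x + W (flip j x))) := by
    have := hW x
    have := hW (flip j x)
    have h1 : √(W x) * √(W x) = W x := Real.mul_self_sqrt (hW _).le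
    have h2 : 0 < √(W x) := Real.sqrt_pos.2 (hW _)
    rw [flipRatio, Real.sqrt_div (hW _).le]
    field_simp
    rw [pow_two, h1]
  have hx : ((√(W x) : ℝ) : ℂ) ≠ 0 := by
    exact_mod_cast (Real.sqrt_pos.2 (hW x)).ne'
  have hfx : ((√(W (flip j x)) : ℝ) : ℂ) ≠ 0 := by
    exact_mod_cast (Real.sqrt_pos.2 (hW _)).ne'
  have hc : ((√(W (flip j x)) / (W x + W (flip j x)) : ℝ) : ℂ) ≠ 0 := by
    exact_mod_cast (div_pos (Real.sqrt_pos.2 (hW _)) (add_pos (hW _) (hW _))).ne'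
  rw [e1, e2, Complex.ofReal_mul, Complex.ofReal_mul, div_eq_div_iff hfx hx, sub_eq_zero]
  constructor
  · intro h
    apply mul_left_cancel₀ hc
    linear_combination -h
  · intro h
    linear_combination -((√(W (flip j x)) / (W x + W (flip j x)) : ℝ) : ℂ) * h

/-- On each pair `{x, flip j x}` the block is the rank-one projector orthogonal to `(√(W x), √(W
(flip j x)))`. Together with hermiticity this yields positivity, as `P = Pᴴ * P`. -/
theorem heatBath_mul_self (hW : ∀ z, 0 < W z) (j : Fin N) :
    heatBath W j * heatBath W j = heatBath W j := by
  refine Matrix.ext_of_mulVec_single fun y => ?_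
  set ψ : Bits N → ℂ := Pi.single y 1
  rw [← Matrix.mulVec_mulVec]
  ext x
  rw [heatBath_mulVec, heatBath_mulVec, heatBath_mulVec, flip_flip, flipRatio_flip]
  have hq := flipRatio_pos hW j x
  set q := flipRatio W j x
  rw [Real.sqrt_inv]
  have h1 : √q * √q = q := Real.mul_self_sqrt hq.le
  have h2 : 0 < √q := Real.sqrt_pos.2 hq
  set s := √q
  rw [← h1]
  have h3 : (1 + (s : ℂ) * s) ≠ 0 := by
    have : (0 : ℝ) < 1 + s * s := by positivity
    exact_mod_cast this.ne'
  have h4 : (s : ℂ) ≠ 0 := by exact_mod_cast h2.ne'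
  have h5 : (1 + ((s : ℂ) * s)⁻¹) ≠ 0 := by
    have : (0 : ℝ) < 1 + (s * s)⁻¹ := by positivity
    exact_mod_cast this.ne'
  have h6 : ((s : ℂ) * s) + 1 ≠ 0 := by rwa [add_comm]
  have h7 : (s : ℂ) ^ 2 + 1 ≠ 0 := by rwa [pow_two]
  have h8 : 1 + (s : ℂ) ^ 2 ≠ 0 := by rwa [pow_two]
  push_cast
  field_simp
  ring

theorem heatBath_posSemidef (hW : ∀ z, 0 < W z) (j : Fin N) : (heatBath W j).PosSemidef := by
  have h := Matrix.posSemidef_conjTranspose_mul_self (heatBath W j)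
  rwa [(heatBath_isHermitian hW j).eq, heatBath_mul_self hW j] at h

theorem heatBath_stoquastic (j : Fin N) (hW : ∀ z, 0 < W z) (x y : Bits N) (h : x ≠ y) :
    (heatBath W j x y).im = 0 ∧ (heatBath W j x y).re ≤ 0 := by
  unfold heatBath
  rw [if_neg h]
  have hq := flipRatio_pos hW j x
  split_ifs
  · refine ⟨Complex.ofReal_im _, ?_⟩
    rw [Complex.ofReal_re, neg_nonpos]
    positivity
  · simp

theorem heatBath_actsOn {j : Fin N} {S : Finset (Fin N)} (hS : IsBlanket W j S) :
    ActsOn (heatBath W j) S := by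
  classical
  obtain ⟨hj, hq⟩ := hS
  -- Bits outside `S` may be filled in arbitrarily, since the flip ratio at `j` ignores them.
  let ext' : (S → Bool) → Bits N := fun a i => if h : i ∈ S then a ⟨i, h⟩ else false
  refine ⟨fun a b => heatBath W j (ext' a) (ext' b), fun x y => ?_⟩
  have hin : ∀ (x : Bits N) i, i ∈ S → ext' (fun i => x i) i = x i := by
    intro x i hi
    simp [ext', hi]
  have hout : ∀ a i, i ∉ S → ext' a i = false := by
    intro a i hi
    simp [ext', hi]
  by_cases hxy : ∀ i, i ∉ S → x i = y i
  · rw [if_pos hxy]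
    have hr : flipRatio W j (ext' fun i => x i) = flipRatio W j x := hq _ _ (hin x)
    have e1 : ((ext' fun i => x i) = ext' fun i => y i) ↔ x = y := by
      constructor
      · intro h
        ext i
        by_cases hi : i ∈ S
        · rw [← hin x i hi, ← hin y i hi, h]
        · exact hxy i hi
      · rintro rfl; rfl
    have e2 : ((ext' fun i => y i) = flip j (ext' fun i => x i)) ↔ y = flip j x := by
      constructor
      · intro h
        ext i
        by_cases hi : i ∈ S
        · rw [← hin y i hi, h]
          by_cases hij : i = j
          · subst hij; simp [hin x i hi]
          · rw [flip_of_ne hij, flip_of_ne hij, hin x i hi]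
        · rw [flip_of_ne (fun e : i = j => hi (e ▸ hj)), hxy i hi]
      · intro h
        ext i
        by_cases hi : i ∈ S
        · rw [hin y i hi, h]
          by_cases hij : i = j
          · subst hij; simp [hin x i hi]
          · rw [flip_of_ne hij, flip_of_ne hij, hin x i hi]
        · rw [flip_of_ne (fun e : i = j => hi (e ▸ hj))]; simp [ext', hi]
    simp only [heatBath, hr, e1, e2]
  · rw [if_neg hxy]
    unfold heatBath
    rw [if_neg, if_neg]
    · rintro rfl
      exact hxy fun i hi => (flip_of_ne (fun e : i = j => hi (e ▸ hj)) x).symm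
    · rintro rfl
      exact hxy fun i _ => rfl

/-- The entry between two labels differing only at `j` is nonzero, whereas an operator trivial on
`j` vanishes there. -/
theorem heatBath_not_actsOn (hW : ∀ z, 0 < W z) (j : Fin N) :
    ¬ ActsOn (heatBath W j) {j}ᶜ := by
  rintro ⟨B, hB⟩
  have h := hB (fun _ => false) (flip j fun _ => false)
  rw [if_neg] at h
  · unfold heatBath at h
    rw [if_neg (flip_ne _ _).symm, if_pos rfl, Complex.ofReal_eq_zero, neg_eq_zero] at h
    have hq := flipRatio_pos hW j (fun _ => false)
    have : 0 < √(flipRatio W j fun _ => false) / (1 + flipRatio W j fun _ => false) := by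
      positivity
    exact this.ne' h
  · intro h2
    have := h2 j (by simp)
    simp at this

end HeatBath

/-! ### Ground spaces and the parent Hamiltonian of a positive weight. -/

theorem mem_energies_iff {n : ℕ} {A : Operator n} {e : ℝ} :
    e ∈ energies A ↔ ∃ ψ : Bits n → ℂ, ψ ≠ 0 ∧ A.mulVec ψ = (e : ℂ) • ψ := by
  constructor
  · intro h
    obtain ⟨ψ, h1, h2⟩ := Module.End.HasEigenvalue.exists_hasEigenvector h
    rw [Module.End.mem_eigenspace_iff] at h1
    refine ⟨ψ.ofLp, fun h => h2 (by ext x; exact congrFun h x), ?_⟩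
    have := congrArg WithLp.ofLp h1
    simpa [Matrix.toLpLin_apply] using this
  · rintro ⟨ψ, h1, h2⟩
    refine Module.End.hasEigenvalue_of_hasEigenvector (x := WithLp.toLp 2 ψ) ⟨?_, ?_⟩
    · rw [Module.End.mem_eigenspace_iff, Matrix.toLpLin_apply]
      simp [h2]
    · simpa using h1

theorem mem_groundSpace_iff {n : ℕ} {A : Operator n} {ψ : StateSpace n} :
    ψ ∈ groundSpace A ↔ A.mulVec ψ.ofLp = (groundEnergy A : ℂ) • ψ.ofLp := by
  rw [groundSpace, Module.End.mem_eigenspace_iff, Matrix.toLpLin_apply]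
  constructor
  · intro h
    simpa using congrArg WithLp.ofLp h
  · intro h
    rw [h]
    simp

theorem groundEnergy_eq_zero {n : ℕ} {A : Operator n} (hA : A.PosSemidef) {φ : Bits n → ℂ}
    (hφ : φ ≠ 0) (h : A.mulVec φ = 0) : groundEnergy A = 0 := by
  have hl := isLeast_groundEnergy hA.isHermitian
  apply le_antisymm
  · exact hl.2 (mem_energies_iff.2 ⟨φ, hφ, by simp [h]⟩)
  · obtain ⟨ψ, h1, h2⟩ := mem_energies_iff.1 hl.1
    have h3 := hA.dotProduct_mulVec_nonneg ψ
    rw [h2, dotProduct_smul, smul_eq_mul] at h3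
    have h4 : 0 < star ψ ⬝ᵥ ψ := Matrix.dotProduct_star_self_pos_iff.2 h1
    by_contra hneg
    push Not at hneg
    have h6 : (groundEnergy A : ℂ) < 0 := by exact_mod_cast hneg
    exact absurd h3 (not_le_of_gt (mul_neg_of_neg_of_pos h6 h4))

/-- All amplitudes are proportional to a given one if this is so for single bit flips. -/
theorem eq_of_flip_invariant {V : Type*} [Fintype V] [DecidableEq V] {α : Type*}
    {F : (V → Bool) → α} (h : ∀ v z, F (flip v z) = F z) (z z' : V → Bool) : F z = F z' := by
  have key : ∀ S : Finset V, F (fun u => if u ∈ S then z u else z' u) = F z' := by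
    intro S
    induction S using Finset.induction_on with
    | empty => simp
    | insert a S ha ih =>
      rw [← ih]
      by_cases haz : z a = z' a
      · congr 1
        ext u
        by_cases hu : u = a
        · subst hu; simp [ha, haz]
        · simp [hu]
      · rw [← h a (fun u => if u ∈ S then z u else z' u)]
        congr 1
        ext u
        by_cases hu : u = a
        · subst hu
          simp only [Finset.mem_insert_self, if_true, flip_same, ha, if_false]
          exact Bool.eq_not.2 haz
        · simp [flip_of_ne hu, hu]
  simpa using (key Finset.univ)

/-- A positive weight whose flip ratios depend on at most `k` bits is, up to normalization, the
distribution of the unique ground state of a `k`-local stoquastic frustration-free Hamiltonian. -/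
theorem exists_parentHamiltonian {N k : ℕ} {W : Bits N → ℝ} (hW : ∀ z, 0 < W z)
    (hS : ∀ j, ∃ S : Finset (Fin N), IsBlanket W j S ∧ S.card ≤ k) :
    ∃ (H : LocalHamiltonian N N k) (φ : StateSpace N),
      H.IsStoquastic ∧ H.IsFrustrationFree ∧ (∀ j, ¬ ActsOn (H.term j) {j}ᶜ) ∧ ‖φ‖ = 1 ∧
      groundSpace H.total = Submodule.span ℂ {φ} ∧
      ∀ x, distribution φ x = W x / ∑ y, W y := by
  let H : LocalHamiltonian N N k :=
    { term := heatBath W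
      isHermitian := heatBath_isHermitian hW
      isLocal := fun a => by
        obtain ⟨S, h1, h2⟩ := hS a
        exact ⟨S, h2, heatBath_actsOn h1⟩ }
  have hZ : 0 < ∑ y, W y := Finset.sum_pos (fun y _ => hW y) Finset.univ_nonempty
  let φ : StateSpace N := WithLp.toLp 2 fun x => ((√(W x) / √(∑ y, W y) : ℝ) : ℂ)
  have hdist : ∀ x, distribution φ x = W x / ∑ y, W y := by
    intro x
    simp only [distribution, φ]
    rw [Complex.norm_real, Real.norm_eq_abs, sq_abs, div_pow, Real.sq_sqrt (hW x).le,
      Real.sq_sqrt hZ.le]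
  have hφ1 : ‖φ‖ = 1 := by
    rw [EuclideanSpace.norm_eq, Real.sqrt_eq_one]
    calc ∑ x, ‖φ x‖ ^ 2 = ∑ x, W x / ∑ y, W y := Finset.sum_congr rfl fun x _ => hdist x
      _ = 1 := by rw [← Finset.sum_div, div_self hZ.ne']
  have hφ0 : φ.ofLp ≠ 0 := by
    intro h
    have : φ = 0 := by ext x; exact congrFun h x
    rw [this, norm_zero] at hφ1
    exact zero_ne_one hφ1
  have hker : ∀ j, (heatBath W j).mulVec φ.ofLp = 0 := by
    intro j
    rw [heatBath_mulVec_eq_zero hW]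
    have : ∀ x, φ.ofLp x / ((√(W x) : ℝ) : ℂ) = ((1 / √(∑ y, W y) : ℝ) : ℂ) := by
      intro x
      have hx := Real.sqrt_pos.2 (hW x)
      simp only [φ]
      rw [← Complex.ofReal_div]
      congr 1
      field_simp
    intro x
    rw [this, this]
  have hps : H.total.PosSemidef :=
    Matrix.posSemidef_sum _ fun j _ => heatBath_posSemidef hW j
  have hmv : ∀ ψ : Bits N → ℂ, H.total.mulVec ψ = ∑ j, (heatBath W j).mulVec ψ := fun ψ =>
    Matrix.sum_mulVec _ _ _
  have hE : groundEnergy H.total = 0 :=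
    groundEnergy_eq_zero hps hφ0 (by rw [hmv]; exact Finset.sum_eq_zero fun j _ => hker j)
  have hEj : ∀ j, groundEnergy (heatBath W j) = 0 := fun j =>
    groundEnergy_eq_zero (heatBath_posSemidef hW j) hφ0 (hker j)
  -- The quadratic forms of the positive semidefinite terms sum to zero, so each vanishes. This
  -- gives both frustration freeness and uniqueness.
  have hff : ∀ ψ : Bits N → ℂ, H.total.mulVec ψ = 0 → ∀ j, (heatBath W j).mulVec ψ = 0 := by
    intro ψ hψ j
    rw [← (heatBath_posSemidef hW j).dotProduct_mulVec_zero_iff]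
    have h0 : ∑ j, star ψ ⬝ᵥ (heatBath W j).mulVec ψ = 0 := by
      rw [← dotProduct_sum, ← hmv, hψ, dotProduct_zero]
    exact (Finset.sum_eq_zero_iff_of_nonneg
      (fun j _ => (heatBath_posSemidef hW j).dotProduct_mulVec_nonneg ψ)).1 h0 j
        (Finset.mem_univ j)
  refine ⟨H, φ, fun a x y h => heatBath_stoquastic a hW x y h, ?_,
    heatBath_not_actsOn hW, hφ1, ?_, hdist⟩
  · intro j ψ hψ
    rw [mem_groundSpace_iff, hE, Complex.ofReal_zero, zero_smul] at hψ
    rw [mem_groundSpace_iff]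
    show (heatBath W j).mulVec ψ.ofLp = (groundEnergy (heatBath W j) : ℂ) • ψ.ofLp
    rw [hEj, Complex.ofReal_zero, zero_smul]
    exact hff _ hψ j
  · apply le_antisymm
    · intro ψ hψ
      rw [mem_groundSpace_iff, hE, Complex.ofReal_zero, zero_smul] at hψ
      have h1 := hff _ hψ
      let z₀ : Bits N := fun _ => false
      -- The ratio `ψ / √W` is invariant under all single flips, and these connect the whole
      -- hypercube.
      have h2 : ∀ x, ψ.ofLp x / ((√(W x) : ℝ) : ℂ) = ψ.ofLp z₀ / ((√(W z₀) : ℝ) : ℂ) := fun x =>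
        eq_of_flip_invariant (F := fun x => ψ.ofLp x / ((√(W x) : ℝ) : ℂ))
          (fun j x => (heatBath_mulVec_eq_zero hW j _).1 (h1 j) x) x z₀
      rw [Submodule.mem_span_singleton]
      refine ⟨(ψ.ofLp z₀ / ((√(W z₀) : ℝ) : ℂ)) * ((√(∑ y, W y) : ℝ) : ℂ), ?_⟩
      ext x
      have hx : ((√(W x) : ℝ) : ℂ) ≠ 0 := by exact_mod_cast (Real.sqrt_pos.2 (hW x)).ne'
      have hz : ((√(∑ y, W y) : ℝ) : ℂ) ≠ 0 := by exact_mod_cast (Real.sqrt_pos.2 hZ).ne'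
      rw [PiLp.smul_apply, smul_eq_mul, ← h2 x]
      simp only [φ]
      rw [Complex.ofReal_div]
      field_simp
    · rw [Submodule.span_singleton_le_iff_mem, mem_groundSpace_iff, hE, Complex.ofReal_zero,
        zero_smul, hmv]
      exact Finset.sum_eq_zero fun j _ => hker j

/-! ### Calculus of Markov blankets. -/

section Blanket

variable {V U : Type*} [DecidableEq V] [DecidableEq U]

/-- Flip ratios are multiplicative in the weight. -/
theorem IsBlanket.mul {W₁ W₂ : (V → Bool) → ℝ} {v : V} {S₁ S₂ : Finset V}
    (h₁ : IsBlanket W₁ v S₁) (h₂ : IsBlanket W₂ v S₂) :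
    IsBlanket (fun z => W₁ z * W₂ z) v (S₁ ∪ S₂) := by
  refine ⟨Finset.mem_union_left _ h₁.1, fun z z' h => ?_⟩
  have e₁ := h₁.2 z z' fun u hu => h u (Finset.mem_union_left _ hu)
  have e₂ := h₂.2 z z' fun u hu => h u (Finset.mem_union_right _ hu)
  simp only [flipRatio] at *
  rw [mul_div_mul_comm, mul_div_mul_comm, e₁, e₂]

theorem flip_comp_of_injective {e : U → V} (he : Function.Injective e) (u : U) (z : V → Bool) :
    flip (e u) z ∘ e = flip u (z ∘ e) := by
  ext w
  by_cases hw : w = u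
  · subst hw; simp
  · simp [flip_of_ne hw, flip_of_ne (he.ne hw)]

omit [DecidableEq U] in
theorem flip_comp_of_notMem_range {e : U → V} {v : V} (hv : ∀ u, e u ≠ v) (z : V → Bool) :
    flip v z ∘ e = z ∘ e := by
  ext w
  simp [flip_of_ne (hv w)]

theorem IsBlanket.comp {W : (U → Bool) → ℝ} {u : U} {S : Finset U} (h : IsBlanket W u S)
    {e : U → V} (he : Function.Injective e) :
    IsBlanket (fun z => W (z ∘ e)) (e u) (S.image e) := by
  refine ⟨Finset.mem_image_of_mem e h.1, fun z z' hz => ?_⟩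
  have := h.2 (z ∘ e) (z' ∘ e) fun w hw => hz _ (Finset.mem_image_of_mem e hw)
  simpa only [flipRatio, flip_comp_of_injective he] using this

theorem isBlanket_of_flip_eq {W : (V → Bool) → ℝ} (hW : ∀ z, 0 < W z) {v : V}
    (h : ∀ z, W (flip v z) = W z) : IsBlanket W v {v} := by
  refine ⟨Finset.mem_singleton_self v, fun z z' _ => ?_⟩
  rw [flipRatio, flipRatio, h, h, div_self (hW z).ne', div_self (hW z').ne']

theorem isBlanket_of_dependsOn {W : (V → Bool) → ℝ} {v : V} {S : Finset V} (hv : v ∈ S)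
    (h : ∀ z z', (∀ u ∈ S, z u = z' u) → W z = W z') : IsBlanket W v S := by
  refine ⟨hv, fun z z' hz => ?_⟩
  rw [flipRatio, flipRatio, h z z' hz, h (flip v z) (flip v z')]
  intro u hu
  by_cases huv : u = v
  · subst huv; simp [hz u hu]
  · rw [flip_of_ne huv, flip_of_ne huv, hz u hu]

end Blanket

/-! ### From gate lists to weights with hidden bits, and to Hamiltonians. -/

/-- A gate with real amplitudes acting on some of `n` qubits. -/
structure Gate (n : ℕ) where
  /-- The qubits acted on. -/
  supp : Finset (Fin n)
  /-- The amplitudes. -/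
  amp : Matrix (supp → Bool) (supp → Bool) ℝ

/-- Overwrite the bits in `S`. -/
def overwrite {n : ℕ} (S : Finset (Fin n)) (x : Bits n) (s : S → Bool) : Bits n :=
  fun i => if h : i ∈ S then s ⟨i, h⟩ else x i

/-- The action of a gate on real functions of `n` bits. -/
def Gate.apply {n : ℕ} (g : Gate n) (f : Bits n → ℝ) (x : Bits n) : ℝ :=
  ∑ s : g.supp → Bool, g.amp (fun i => x i) s * f (overwrite g.supp x s)

/-- The result of applying a list of gates, the last one first, to the constant function `1`. -/
def applyGates {n : ℕ} (gs : List (Gate n)) : Bits n → ℝ :=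
  gs.foldr (fun g f => g.apply f) fun _ => 1

/-- A list of positive gates is represented by a positive weight on the input bits and some hidden
bits, where the flip ratios depend on few bits. -/
theorem exists_network {n k : ℕ} (hk : 1 ≤ k) (gs : List (Gate n))
    (hcard : ∀ g ∈ gs, g.supp.card ≤ k) (hpos : ∀ g ∈ gs, ∀ a b, 0 < g.amp a b) :
    ∃ (M : Type) (_ : Fintype M) (_ : DecidableEq M) (W : (Fin n ⊕ M → Bool) → ℝ),
      (∀ z, 0 < W z) ∧
      (∀ i, ∃ S, IsBlanket W (Sum.inl i) S ∧ S.card ≤ 2 * k) ∧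
      (∀ h, ∃ S, IsBlanket W (Sum.inr h) S ∧ S.card ≤ 4 * k) ∧
      (∀ x, ∑ h : M → Bool, W (Sum.elim x h) = applyGates gs x) ∧
      Fintype.card M ≤ k * gs.length := by
  induction gs with
  | nil =>
    refine ⟨Empty, inferInstance, inferInstance, fun _ => 1, fun _ => zero_lt_one, fun i => ?_,
      fun h => h.elim, fun x => ?_, ?_⟩
    · refine ⟨{Sum.inl i}, isBlanket_of_flip_eq (fun _ => zero_lt_one) fun _ => rfl, ?_⟩
      rw [Finset.card_singleton]; omega
    · simp [applyGates]
    · simp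
  | cons g gs ih =>
    obtain ⟨M, _, _, W, hW, hin, hhid, hsum, hM⟩ := ih (fun g hg => hcard g (by simp [hg]))
      (fun g hg => hpos g (by simp [hg]))
    have hgk := hcard g (by simp)
    have hgp := hpos g (by simp)
    -- The new gate is applied last: its output is read from the visible bits in its support, its
    -- input from fresh hidden bits. The older weight reads those fresh bits in place of the visible
    -- ones.
    let e : Fin n ⊕ M → Fin n ⊕ (g.supp ⊕ M) := Sum.elim
      (fun i => if h : i ∈ g.supp then Sum.inr (Sum.inl ⟨i, h⟩) else Sum.inl i)
      (fun m => Sum.inr (Sum.inr m))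
    have e1 : ∀ i (h : i ∈ g.supp), e (Sum.inl i) = Sum.inr (Sum.inl ⟨i, h⟩) := by
      intro i h; simp [e, h]
    have e2 : ∀ i, i ∉ g.supp → e (Sum.inl i) = Sum.inl i := by
      intro i h; simp [e, h]
    have e3 : ∀ m, e (Sum.inr m) = Sum.inr (Sum.inr m) := fun m => rfl
    have he : Function.Injective e := by
      rintro (i | m) (j | m') h
      · by_cases hi : i ∈ g.supp <;> by_cases hj : j ∈ g.supp <;>
          simp_all
      · by_cases hi : i ∈ g.supp
        · rw [e1 i hi, e3] at h; simp at h
        · rw [e2 i hi, e3] at h; simp at h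
      · by_cases hi : j ∈ g.supp
        · rw [e1 j hi, e3] at h; simp at h
        · rw [e2 j hi, e3] at h; simp at h
      · rw [e3, e3] at h; simpa using h
    let G : (Fin n ⊕ (g.supp ⊕ M) → Bool) → ℝ := fun z =>
      g.amp (fun i => z (Sum.inl i)) (fun i => z (Sum.inr (Sum.inl i)))
    have hG : ∀ z, 0 < G z := fun z => hgp _ _
    let T : Finset (Fin n ⊕ (g.supp ⊕ M)) :=
      g.supp.image Sum.inl ∪ Finset.univ.image fun i : g.supp => Sum.inr (Sum.inl i)
    have hT : T.card ≤ 2 * k := by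
      refine (Finset.card_union_le _ _).trans ?_
      have h1 := Finset.card_image_le (s := g.supp)
        (f := (Sum.inl : Fin n → Fin n ⊕ (g.supp ⊕ M)))
      have h2 := Finset.card_image_le (s := (Finset.univ : Finset g.supp))
        (f := fun i : g.supp => (Sum.inr (Sum.inl i) : Fin n ⊕ (g.supp ⊕ M)))
      rw [Finset.card_univ, Fintype.card_coe] at h2
      omega
    have hGdep : ∀ z z', (∀ u ∈ T, z u = z' u) → G z = G z' := by
      intro z z' h
      have ha : ∀ i : g.supp, z (Sum.inl i) = z' (Sum.inl i) := fun i =>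
        h _ (Finset.mem_union_left _ (Finset.mem_image_of_mem _ i.2))
      have hb : ∀ i : g.supp, z (Sum.inr (Sum.inl i)) = z' (Sum.inr (Sum.inl i)) := fun i =>
        h _ (Finset.mem_union_right _ (Finset.mem_image_of_mem _ (Finset.mem_univ i)))
      simp only [G, ha, hb]
    have hGout : ∀ v, v ∉ T → IsBlanket G v {v} := by
      intro v hv
      refine isBlanket_of_flip_eq hG fun z => hGdep _ _ fun u hu => ?_
      exact flip_of_ne (fun h : u = v => hv (h ▸ hu)) z
    refine ⟨g.supp ⊕ M, inferInstance, inferInstance, fun z => G z * W (z ∘ e),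
      fun z => mul_pos (hG z) (hW _), fun i => ?_, ?_, fun x => ?_, ?_⟩
    -- A visible bit in the support now enters only the new gate, and any other visible bit only the
    -- older weight. The bound `2 * k` therefore persists without growing.
    · by_cases hi : i ∈ g.supp
      · have hiT : Sum.inl i ∈ T := Finset.mem_union_left _ (Finset.mem_image_of_mem _ hi)
        refine ⟨T ∪ {Sum.inl i}, (isBlanket_of_dependsOn hiT hGdep).mul
          (isBlanket_of_flip_eq (fun z => hW _) fun z => ?_), ?_⟩
        · rw [flip_comp_of_notMem_range]
          rintro (j | m) h
          · by_cases hj : j ∈ g.supp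
            · rw [e1 j hj] at h; simp at h
            · rw [e2 j hj] at h
              exact hj (Sum.inl_injective h ▸ hi)
          · rw [e3] at h; simp at h
        · rwa [Finset.union_eq_left.2 (Finset.singleton_subset_iff.2 hiT)]
      · obtain ⟨S, hS, hc⟩ := hin i
        have hiT : Sum.inl i ∉ T := by simp [T, hi]
        have h := (hGout _ hiT).mul (e2 i hi ▸ hS.comp he)
        refine ⟨_, h, ?_⟩
        rw [Finset.union_eq_right.2]
        · exact Finset.card_image_le.trans hc
        · rw [Finset.singleton_subset_iff, ← e2 i hi]
          exact Finset.mem_image_of_mem e hS.1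
    -- A fresh hidden bit sees the new gate (`2 * k` bits) and inherits the blanket of the former
    -- visible bit (`2 * k` bits). Older hidden bits keep theirs.
    · rintro (i | m)
      · obtain ⟨S, hS, hc⟩ := hin i
        have hiT : Sum.inr (Sum.inl i) ∈ T :=
          Finset.mem_union_right _ (Finset.mem_image_of_mem _ (Finset.mem_univ i))
        refine ⟨_, (isBlanket_of_dependsOn hiT hGdep).mul (e1 i i.2 ▸ hS.comp he), ?_⟩
        have h1 := Finset.card_union_le T (S.image e)
        have h2 : (S.image e).card ≤ S.card := Finset.card_image_le
        omega
      · obtain ⟨S, hS, hc⟩ := hhid m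
        have hiT : Sum.inr (Sum.inr m) ∉ T := by simp [T]
        refine ⟨_, (hGout _ hiT).mul (hS.comp he), ?_⟩
        rw [Finset.union_eq_right.2]
        · exact Finset.card_image_le.trans hc
        · rw [Finset.singleton_subset_iff, ← e3 m]
          exact Finset.mem_image_of_mem e hS.1
    · rw [← (Equiv.sumArrowEquivProdArrow g.supp M Bool).symm.sum_comp, Fintype.sum_prod_type]
      show _ = g.apply (applyGates gs) x
      refine Finset.sum_congr rfl fun s _ => ?_
      rw [← hsum, Finset.mul_sum]
      refine Finset.sum_congr rfl fun h _ => ?_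
      refine congrArg₂ (· * ·) rfl (congrArg W ?_)
      ext (i | m)
      · by_cases hi : i ∈ g.supp
        · simp [e1 i hi, overwrite, hi, Equiv.sumArrowEquivProdArrow]
        · simp [e2 i hi, overwrite, hi]
      · simp [e3, Equiv.sumArrowEquivProdArrow]
    · rw [Fintype.card_sum, Fintype.card_coe, List.length_cons, mul_add, mul_one]
      omega

/-- The square of the function computed by a list of positive `k`-local gates is, up to
normalization, the marginal distribution of the unique ground state of a `4k`-local stoquastic
frustration-free Hamiltonian. -/
theorem exists_hamiltonian_of_gates {n k : ℕ} (hk : 1 ≤ k) (gs : List (Gate n))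
    (hcard : ∀ g ∈ gs, g.supp.card ≤ k) (hpos : ∀ g ∈ gs, ∀ a b, 0 < g.amp a b) :
    ∃ (m : ℕ) (H : LocalHamiltonian (n + m) (n + m) (4 * k)) (φ : StateSpace (n + m)),
      H.IsStoquastic ∧ H.IsFrustrationFree ∧ (∀ j, ¬ ActsOn (H.term j) {j}ᶜ) ∧ ‖φ‖ = 1 ∧
      groundSpace H.total = Submodule.span ℂ {φ} ∧
      (∀ x, marginal (distribution φ) x = applyGates gs x ^ 2 / ∑ y, applyGates gs y ^ 2) ∧
      m ≤ 2 * (k * gs.length) := by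
  obtain ⟨M, _, _, W, hW, hin, hhid, hsum, hM⟩ := exists_network hk gs hcard hpos
  -- Squaring: two copies of the hidden bits over the same visible bits, selected by `l` and `r`.
  let l : Fin n ⊕ M → Fin n ⊕ (M ⊕ M) := Sum.map id Sum.inl
  let r : Fin n ⊕ M → Fin n ⊕ (M ⊕ M) := Sum.map id Sum.inr
  have hl : Function.Injective l := Function.injective_id.sumMap Sum.inl_injective
  have hr : Function.Injective r := Function.injective_id.sumMap Sum.inr_injective
  let W₂ : (Fin n ⊕ (M ⊕ M) → Bool) → ℝ := fun z => W (z ∘ l) * W (z ∘ r)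
  have hW₂ : ∀ z, 0 < W₂ z := fun z => mul_pos (hW _) (hW _)
  -- Visible bits lie in both copies, giving `2 * k + 2 * k`; hidden bits lie in just one, where the
  -- bound is already `4 * k`.
  have hbl : ∀ v, ∃ S, IsBlanket W₂ v S ∧ S.card ≤ 4 * k := by
    rintro (i | h | h)
    · obtain ⟨S, hS, hc⟩ := hin i
      refine ⟨_, (hS.comp hl).mul (hS.comp hr), (Finset.card_union_le _ _).trans ?_⟩
      have h1 : (S.image l).card ≤ S.card := Finset.card_image_le
      have h2 : (S.image r).card ≤ S.card := Finset.card_image_le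
      omega
    · obtain ⟨S, hS, hc⟩ := hhid h
      refine ⟨_, (hS.comp hl).mul (isBlanket_of_flip_eq (fun z => hW _) fun z => ?_), ?_⟩
      · rw [flip_comp_of_notMem_range]
        rintro (i | h) <;> simp [l, r]
      · rw [Finset.union_eq_left.2]
        · exact Finset.card_image_le.trans hc
        · rw [Finset.singleton_subset_iff]
          exact Finset.mem_image_of_mem l hS.1
    · obtain ⟨S, hS, hc⟩ := hhid h
      have hb : IsBlanket (fun z => W (z ∘ l)) (Sum.inr (Sum.inr h)) {Sum.inr (Sum.inr h)} :=
        isBlanket_of_flip_eq (fun z => hW _) fun z => by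
          rw [flip_comp_of_notMem_range]
          rintro (i | h) <;> simp [l]
      refine ⟨_, hb.mul (hS.comp hr), ?_⟩
      rw [Finset.union_eq_right.2]
      · exact Finset.card_image_le.trans hc
      · rw [Finset.singleton_subset_iff]
        exact Finset.mem_image_of_mem r hS.1
  have hsum₂ : ∀ x, ∑ h : M ⊕ M → Bool, W₂ (Sum.elim x h) = applyGates gs x ^ 2 := by
    intro x
    rw [← (Equiv.sumArrowEquivProdArrow M M Bool).symm.sum_comp, Fintype.sum_prod_type, pow_two,
      ← hsum, Finset.sum_mul_sum]
    refine Finset.sum_congr rfl fun h _ => Finset.sum_congr rfl fun h' _ => ?_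
    simp only [W₂]
    congr 1 <;> congr 1 <;> ext (i | m) <;> simp [l, r, Equiv.sumArrowEquivProdArrow]
  let m := Fintype.card (M ⊕ M)
  let em : M ⊕ M ≃ Fin m := Fintype.equivFin _
  let E : Fin n ⊕ (M ⊕ M) ≃ Fin (n + m) := (Equiv.sumCongr (Equiv.refl _) em).trans finSumFinEquiv
  obtain ⟨H, φ, h1, h2, h3, h4, h5, h6⟩ := exists_parentHamiltonian
    (W := fun z : Bits (n + m) => W₂ (z ∘ E)) (k := 4 * k) (fun z => hW₂ _) fun j => by
      obtain ⟨S, hS, hc⟩ := hbl (E.symm j)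
      refine ⟨S.image E, ?_, Finset.card_image_le.trans hc⟩
      simpa using hS.comp E.injective
  have hmarg : ∀ x, ∑ h : Bits m, W₂ (Fin.append x h ∘ E) = applyGates gs x ^ 2 := by
    intro x
    rw [← hsum₂, ← (em.arrowCongr (Equiv.refl Bool)).sum_comp]
    refine Finset.sum_congr rfl fun h _ => ?_
    congr 1
    ext (i | m)
    · simp [E]
    · simp [E]
  have hZ : ∑ z : Bits (n + m), W₂ (z ∘ E) = ∑ y, applyGates gs y ^ 2 := by
    rw [← (Fin.appendEquiv n m).sum_comp, Fintype.sum_prod_type]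
    exact Finset.sum_congr rfl fun x _ => hmarg x
  refine ⟨m, H, φ, h1, h2, h3, h4, h5, fun x => ?_, ?_⟩
  · rw [marginal, ← hmarg, Finset.sum_div, ← hZ]
    exact Finset.sum_congr rfl fun h _ => h6 _
  · show Fintype.card (M ⊕ M) ≤ _
    rw [Fintype.card_sum]
    omega

/-! ### Second-order accuracy of palindromic products. -/

/-- The remainder of the exponential series after the quadratic term. -/
def expRemainder (x : ℝ) : ℝ := Real.exp x - 1 - x - x ^ 2 / 2

theorem expRemainder_nonneg {x : ℝ} (hx : 0 ≤ x) : 0 ≤ expRemainder x := by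
  have := Real.quadratic_le_exp_of_nonneg hx
  unfold expRemainder
  linarith

theorem expRemainder_le {x : ℝ} (h0 : 0 ≤ x) (h1 : x ≤ 1) : expRemainder x ≤ x ^ 3 := by
  have h := Real.exp_bound (x := x) (by rwa [abs_of_nonneg h0]) (n := 3) (by norm_num)
  rw [abs_of_nonneg h0] at h
  have h2 := (le_abs_self _).trans h
  norm_num [Finset.sum_range_succ, Nat.factorial] at h2
  unfold expRemainder
  have : 0 ≤ x ^ 3 := by positivity
  linarith

section SecondOrder

variable {A : Type*} [NormedRing A] [NormedAlgebra ℂ A] [NormOneClass A]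

/-- `P` agrees with `1 + s₁ + s₂` up to the remainder of the exponential series at `Λ`. -/
structure SecondOrder (P s₁ s₂ : A) (Λ : ℝ) : Prop where
  linear : ‖s₁‖ ≤ Λ
  quadratic : ‖s₂‖ ≤ Λ ^ 2 / 2
  remainder : ‖P - 1 - s₁ - s₂‖ ≤ expRemainder Λ

-- Majorization by the scalar exponential: every bound on a factor or its tails is the corresponding
-- one for `exp`, so the functional equation of `exp` makes the bounds compose without loss.
omit [NormedAlgebra ℂ A] in
theorem SecondOrder.mul {P s₁ s₂ Q t₁ t₂ : A} {Λ M : ℝ} (hP : SecondOrder P s₁ s₂ Λ)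
    (hQ : SecondOrder Q t₁ t₂ M) :
    SecondOrder (P * Q) (s₁ + t₁) (s₂ + s₁ * t₁ + t₂) (Λ + M) := by
  have hΛ : 0 ≤ Λ := (norm_nonneg _).trans hP.linear
  have hM : 0 ≤ M := (norm_nonneg _).trans hQ.linear
  have q2 : ‖Q - 1 - t₁‖ ≤ Real.exp M - 1 - M := by
    calc ‖Q - 1 - t₁‖ = ‖(Q - 1 - t₁ - t₂) + t₂‖ := by congr 1; abel
      _ ≤ ‖Q - 1 - t₁ - t₂‖ + ‖t₂‖ := norm_add_le _ _
      _ ≤ expRemainder M + M ^ 2 / 2 := add_le_add hQ.remainder hQ.quadratic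
      _ = _ := by unfold expRemainder; ring
  have q1 : ‖Q - 1‖ ≤ Real.exp M - 1 := by
    calc ‖Q - 1‖ = ‖(Q - 1 - t₁) + t₁‖ := by congr 1; abel
      _ ≤ ‖Q - 1 - t₁‖ + ‖t₁‖ := norm_add_le _ _
      _ ≤ (Real.exp M - 1 - M) + M := add_le_add q2 hQ.linear
      _ = _ := by ring
  have q0 : ‖Q‖ ≤ Real.exp M := by
    calc ‖Q‖ = ‖(Q - 1) + 1‖ := by congr 1; abel
      _ ≤ ‖Q - 1‖ + ‖(1 : A)‖ := norm_add_le _ _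
      _ ≤ (Real.exp M - 1) + 1 := add_le_add q1 norm_one.le
      _ = _ := by ring
  refine ⟨(norm_add_le _ _).trans (add_le_add hP.linear hQ.linear), ?_, ?_⟩
  · calc ‖s₂ + s₁ * t₁ + t₂‖ ≤ ‖s₂‖ + ‖s₁‖ * ‖t₁‖ + ‖t₂‖ :=
        (norm_add_le _ _).trans (add_le_add_left
          ((norm_add_le _ _).trans (add_le_add_right (norm_mul_le _ _) _)) _)
      _ ≤ Λ ^ 2 / 2 + Λ * M + M ^ 2 / 2 :=
        add_le_add (add_le_add hP.quadratic
          (mul_le_mul hP.linear hQ.linear (norm_nonneg _) hΛ)) hQ.quadratic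
      _ = _ := by ring
  -- Each Taylor coefficient of `P` is paired with the complementary tail of `Q`. The same splitting
  -- of `exp Λ * exp M` makes the final bound an equality of scalars.
  · have e : P * Q - 1 - (s₁ + t₁) - (s₂ + s₁ * t₁ + t₂) =
        (P - 1 - s₁ - s₂) * Q + s₂ * (Q - 1) + s₁ * (Q - 1 - t₁) + (Q - 1 - t₁ - t₂) := by
      noncomm_ring
    rw [e]
    calc _ ≤ ‖P - 1 - s₁ - s₂‖ * ‖Q‖ + ‖s₂‖ * ‖Q - 1‖ + ‖s₁‖ * ‖Q - 1 - t₁‖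
          + ‖Q - 1 - t₁ - t₂‖ := by
          refine (norm_add_le _ _).trans (add_le_add_left ?_ _)
          refine (norm_add_le _ _).trans (add_le_add ?_ (norm_mul_le _ _))
          exact (norm_add_le _ _).trans (add_le_add (norm_mul_le _ _) (norm_mul_le _ _))
      _ ≤ expRemainder Λ * Real.exp M + Λ ^ 2 / 2 * (Real.exp M - 1)
          + Λ * (Real.exp M - 1 - M) + expRemainder M := by
          have := expRemainder_nonneg hΛ
          refine add_le_add (add_le_add (add_le_add ?_ ?_) ?_) hQ.remainder
          · exact mul_le_mul hP.remainder q0 (norm_nonneg _) this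
          · exact mul_le_mul hP.quadratic q1 (norm_nonneg _) (by positivity)
          · exact mul_le_mul hP.linear q2 (norm_nonneg _) hΛ
      _ = expRemainder (Λ + M) := by
          unfold expRemainder
          rw [Real.exp_add]
          ring

/-- The quadratic Taylor polynomial of the exponential. -/
def quadExp (X : A) : A := 1 + X + (1 / 2 : ℂ) • (X * X)

omit [NormOneClass A] in
theorem norm_half_smul_mul_self_le (X : A) : ‖(1 / 2 : ℂ) • (X * X)‖ ≤ ‖X‖ ^ 2 / 2 := by
  rw [norm_smul]
  have := norm_mul_le X X
  norm_num
  linarith [pow_two ‖X‖]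

omit [NormOneClass A] in
theorem secondOrder_quadExp (X : A) :
    SecondOrder (quadExp X) X ((1 / 2 : ℂ) • (X * X)) ‖X‖ := by
  refine ⟨le_rfl, norm_half_smul_mul_self_le X, ?_⟩
  have : quadExp X - 1 - X - (1 / 2 : ℂ) • (X * X) = 0 := by
    unfold quadExp; abel
  rw [this, norm_zero]
  exact expRemainder_nonneg (norm_nonneg X)

/-- A palindromic product is correct to second order. -/
theorem secondOrder_palindrome (l : List A) :
    SecondOrder ((l ++ l.reverse).map quadExp).prod (2 * l.sum)
      ((1 / 2 : ℂ) • ((2 * l.sum) * (2 * l.sum))) (2 * (l.map norm).sum) := by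
  induction l with
  | nil =>
    refine ⟨by simp, by simp, by simp [expRemainder]⟩
  | cons X l ih =>
    have h := ((secondOrder_quadExp X).mul ih).mul (secondOrder_quadExp X)
    have e1 : ((X :: l ++ (X :: l).reverse).map quadExp).prod =
        quadExp X * ((l ++ l.reverse).map quadExp).prod * quadExp X := by
      simp [mul_assoc]
    have e2 : 2 * (X :: l).sum = X + 2 * l.sum + X := by
      rw [List.sum_cons]; noncomm_ring
    have e4 : 2 * ((X :: l).map norm).sum = ‖X‖ + 2 * (l.map norm).sum + ‖X‖ := by
      rw [List.map_cons, List.sum_cons]; ring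
    -- Wrapping `X` around both sides makes the cross terms symmetric, `X * (2 * l.sum) + (2 *
    -- l.sum) * X`, exactly as in a square. No commutator survives at second order.
    have e3 : (1 / 2 : ℂ) • ((2 * (X :: l).sum) * (2 * (X :: l).sum)) =
        (1 / 2 : ℂ) • (X * X) + X * (2 * l.sum) + (1 / 2 : ℂ) • ((2 * l.sum) * (2 * l.sum))
          + (X + 2 * l.sum) * X + (1 / 2 : ℂ) • (X * X) := by
      rw [e2]
      have h2 : ∀ Y : A, Y = (1 / 2 : ℂ) • (Y + Y) := fun Y => by
        rw [← two_smul ℂ Y, smul_smul]; norm_num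
      rw [h2 (X * (2 * l.sum)), h2 ((X + 2 * l.sum) * X)]
      simp only [← smul_add]
      congr 1
      noncomm_ring
    rw [e1, e2, e4, ← e2, e3, e2]
    exact h

-- Telescoping, with `B` a contraction while `S` may have norm up to `1 + δ`.
omit [NormedAlgebra ℂ A] in
theorem norm_pow_sub_pow_le {S B : A} {δ : ℝ} (hB : ‖B‖ ≤ 1) (h : ‖S - B‖ ≤ δ) (r : ℕ) :
    ‖S ^ r - B ^ r‖ ≤ (1 + δ) ^ r - 1 := by
  have hδ : 0 ≤ δ := (norm_nonneg _).trans h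
  have hS : ‖S‖ ≤ 1 + δ := by
    calc ‖S‖ = ‖B + (S - B)‖ := by congr 1; abel
      _ ≤ _ := (norm_add_le _ _).trans (add_le_add hB h)
  induction r with
  | zero => simp
  | succ r ih =>
    have hBr : ‖B ^ r‖ ≤ 1 := (norm_pow_le B r).trans (pow_le_one₀ (norm_nonneg _) hB)
    have e : S ^ (r + 1) - B ^ (r + 1) = S * (S ^ r - B ^ r) + (S - B) * B ^ r := by
      rw [pow_succ', pow_succ']; noncomm_ring
    rw [e]
    calc _ ≤ ‖S‖ * ‖S ^ r - B ^ r‖ + ‖S - B‖ * ‖B ^ r‖ :=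
        (norm_add_le _ _).trans (add_le_add (norm_mul_le _ _) (norm_mul_le _ _))
      _ ≤ (1 + δ) * ((1 + δ) ^ r - 1) + δ * 1 :=
        add_le_add (mul_le_mul hS ih (norm_nonneg _) (by positivity))
          (mul_le_mul h hBr (norm_nonneg _) hδ)
      _ = _ := by ring

end SecondOrder

/-! ### Approximating the ground space projection. -/

theorem opNorm_le_of_diagonal {ι F : Type*} [Fintype ι] [NormedAddCommGroup F]
    [InnerProductSpace ℂ F] (b : OrthonormalBasis ι ℂ F) (T : F →L[ℂ] F) (c : ι → ℂ)
    (h : ∀ i, T (b i) = c i • b i) {ρ : ℝ} (hρ : 0 ≤ ρ) (hc : ∀ i, ‖c i‖ ≤ ρ) : ‖T‖ ≤ ρ := by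
  classical
  refine ContinuousLinearMap.opNorm_le_bound _ hρ fun v => ?_
  have hT : ∀ i, b.repr (T v) i = c i * b.repr v i := by
    intro i
    conv_lhs => rw [← b.sum_repr v]
    simp [map_sum, h, b.repr_self, Finset.sum_apply, Pi.single_apply]
    ring
  rw [← b.repr.norm_map (T v), ← b.repr.norm_map v, EuclideanSpace.norm_eq, EuclideanSpace.norm_eq,
    Real.sqrt_le_left (by positivity), mul_pow, Real.sq_sqrt (by positivity), Finset.mul_sum]
  refine Finset.sum_le_sum fun i _ => ?_
  rw [hT, norm_mul, mul_pow]
  gcongr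
  exact hc i

section GroundProj

variable {n : ℕ} {M : Operator n}

theorem eigenvalues_mem_energies (hM : M.IsHermitian) (i : Bits n) :
    hM.eigenvalues i ∈ energies M := by
  refine mem_energies_iff.2 ⟨(hM.eigenvectorBasis i).ofLp, fun h => ?_, ?_⟩
  · exact hM.eigenvectorBasis.orthonormal.ne_zero i (by ext x; exact congrFun h x)
  · have := hM.mulVec_eigenvectorBasis i
    rw [this]
    ext x
    simp

theorem toEuclideanCLM_eigenvectorBasis (hM : M.IsHermitian) (i : Bits n) :
    Matrix.toEuclideanCLM (𝕜 := ℂ) M (hM.eigenvectorBasis i) =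
      (hM.eigenvalues i : ℂ) • hM.eigenvectorBasis i := by
  ext x
  rw [Matrix.ofLp_toEuclideanCLM, hM.mulVec_eigenvectorBasis i]
  simp

/-- Eigenspaces of a Hermitian operator for distinct eigenvalues are orthogonal. -/
theorem groundProj_eigenvectorBasis (hM : M.IsHermitian) (i : Bits n) :
    groundProj M (hM.eigenvectorBasis i) =
      (if hM.eigenvalues i = groundEnergy M then (1 : ℂ) else 0) • hM.eigenvectorBasis i := by
  have hmem : hM.eigenvectorBasis i ∈
      Module.End.eigenspace (Matrix.toEuclideanLin M) (hM.eigenvalues i : ℂ) :=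
    Module.End.mem_eigenspace_iff.2 (toEuclideanCLM_eigenvectorBasis hM i)
  split_ifs with h
  · rw [one_smul, groundProj, Submodule.starProjection_eq_self_iff, groundSpace, ← h]
    exact hmem
  · rw [zero_smul, groundProj, Submodule.starProjection_apply_eq_zero_iff]
    rw [Submodule.mem_orthogonal]
    intro w hw
    have hsym : (Matrix.toEuclideanLin M).IsSymmetric :=
      Matrix.isSymmetric_toEuclideanLin_iff.2 hM
    refine hsym.orthogonalFamily_eigenspaces.pairwise ?_ |>.inner_eq hw hmem
    intro h'
    exact h (Complex.ofReal_injective h').symm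

theorem groundEnergy_add_gap_le (hM : M.IsHermitian) {Δ : ℝ} (hΔ : IsEnergyGap M Δ) (i : Bits n)
    (h : hM.eigenvalues i ≠ groundEnergy M) : Δ ≤ hM.eigenvalues i - groundEnergy M := by
  have := hΔ.2 ⟨eigenvalues_mem_energies hM i, h⟩
  linarith

theorem gap_pos (hM : M.IsHermitian) {Δ : ℝ} (hΔ : IsEnergyGap M Δ) : 0 < Δ := by
  have h1 := (isLeast_groundEnergy hM).2 hΔ.1.1
  have h2 : groundEnergy M + Δ ≠ groundEnergy M := hΔ.1.2
  rcases (by linarith : 0 ≤ Δ).lt_or_eq with h | h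
  · exact h
  · exact absurd (by rw [← h, add_zero]) h2

theorem abs_le_opNorm_of_mem_energies {e : ℝ} (he : e ∈ energies M) : |e| ≤ opNorm M := by
  obtain ⟨ψ, h1, h2⟩ := mem_energies_iff.1 he
  have h0 : (0 : ℝ) < ‖(WithLp.toLp 2 ψ : StateSpace n)‖ := by
    rw [norm_pos_iff]; simpa using h1
  have h3 := (Matrix.toEuclideanCLM (𝕜 := ℂ) M).le_opNorm (WithLp.toLp 2 ψ)
  rw [Matrix.toEuclideanCLM_toLp, h2, WithLp.toLp_smul, norm_smul, Complex.norm_real] at h3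
  exact le_of_mul_le_mul_right h3 h0

/-- A power of a palindromic product of quadratic Taylor polynomials approximates the projection
onto the ground space. -/
theorem norm_palindrome_pow_sub_groundProj_le (hM : M.IsHermitian) {Δ τ σ : ℝ}
    (hΔ : IsEnergyGap M Δ) (hτ : 0 ≤ τ) (l : List (StateSpace n →L[ℂ] StateSpace n))
    (hl : 2 * l.sum = -((τ : ℂ) • (Matrix.toEuclideanCLM (𝕜 := ℂ) M - (groundEnergy M : ℂ) • 1)))
    (hσ : 2 * (l.map norm).sum ≤ σ) (hσ1 : σ ≤ 1) (r : ℕ) :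
    ‖((l ++ l.reverse).map quadExp).prod ^ r - groundProj M‖ ≤
      Real.exp (-(r * (τ * Δ / 2))) + ((1 + σ ^ 3) ^ r - 1) := by
  have hso := secondOrder_palindrome l
  set S := ((l ++ l.reverse).map quadExp).prod
  set s := 2 * l.sum
  set T := quadExp s
  -- The step operator `S` is compared with `T = quadExp s`, which is diagonal in an eigenbasis of
  -- `M` because `s` is.
  have hσ0 : 0 ≤ 2 * (l.map norm).sum := (norm_nonneg _).trans hso.linear
  have hST : ‖S - T‖ ≤ σ ^ 3 := by
    have : S - T = S - 1 - s - (1 / 2 : ℂ) • (s * s) := by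
      simp only [T, quadExp]; abel
    rw [this]
    refine (hso.remainder.trans (expRemainder_le hσ0 (hσ.trans hσ1))).trans ?_
    gcongr
  set b := hM.eigenvectorBasis
  set x : Bits n → ℝ := fun i => τ * (hM.eigenvalues i - groundEnergy M) with hx
  have hsb : ∀ i, s (b i) = ((-x i : ℝ) : ℂ) • b i := by
    intro i
    rw [hl]
    simp only [neg_apply, smul_apply,
      sub_apply, one_apply_eq_self]
    rw [toEuclideanCLM_eigenvectorBasis, ← sub_smul, smul_smul, ← neg_smul]
    congr 1
    simp [hx]
  have hx0 : ∀ i, 0 ≤ x i := fun i => mul_nonneg hτ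
    (sub_nonneg.2 ((isLeast_groundEnergy hM).2 (eigenvalues_mem_energies hM i)))
  have hx1 : ∀ i, x i ≤ 1 := by
    intro i
    have h1 := s.le_opNorm (b i)
    rw [hsb, norm_smul, b.norm_eq_one, mul_one, mul_one, Complex.norm_real, Real.norm_eq_abs,
      abs_neg, abs_of_nonneg (hx0 i)] at h1
    exact h1.trans ((hso.linear.trans hσ).trans hσ1)
  set p : Bits n → ℝ := fun i => 1 - x i + x i ^ 2 / 2 with hp
  have hTb : ∀ i, T (b i) = (p i : ℂ) • b i := by
    intro i
    simp only [T, quadExp, add_apply, smul_apply,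
      one_apply_eq_self, mul_apply_eq_comp, hsb, map_smul]
    rw [smul_smul, smul_smul]
    conv_lhs => rw [← one_smul ℂ (b i)]
    rw [smul_smul, smul_smul, ← add_smul, ← add_smul]
    congr 1
    simp only [hp]
    push_cast
    ring
  have hp0 : ∀ i, 0 ≤ p i := fun i => by
    simp only [hp]; nlinarith [sq_nonneg (x i - 1)]
  -- This uses `0 ≤ x i ≤ 1`. It makes `T` a contraction and damps each excited state by at least
  -- `exp (-(τ * Δ / 2))`, while ground states have `p i = 1`.
  have hple : ∀ i, p i ≤ 1 - x i / 2 := fun i => by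
    simp only [hp]; nlinarith [hx0 i, hx1 i]
  have hT1 : ‖T‖ ≤ 1 := by
    refine opNorm_le_of_diagonal b T _ hTb zero_le_one fun i => ?_
    rw [Complex.norm_real, Real.norm_eq_abs, abs_of_nonneg (hp0 i)]
    linarith [hple i, hx0 i]
  have hTpow : ∀ i, (T ^ r) (b i) = ((p i) ^ r : ℂ) • b i := by
    intro i
    induction r with
    | zero => simp
    | succ r ih =>
      rw [pow_succ', mul_apply_eq_comp, ih, map_smul, hTb, smul_smul, pow_succ]
  have hTP : ‖T ^ r - groundProj M‖ ≤ Real.exp (-(r * (τ * Δ / 2))) := by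
    refine opNorm_le_of_diagonal b _
      (fun i => (p i : ℂ) ^ r - if hM.eigenvalues i = groundEnergy M then (1 : ℂ) else 0)
      (fun i => ?_) (Real.exp_nonneg _) fun i => ?_
    · rw [sub_apply, hTpow, groundProj_eigenvectorBasis, ← sub_smul]
    · split_ifs with h
      · have : p i = 1 := by simp [hp, hx, h]
        rw [this]
        simpa using Real.exp_nonneg _
      · rw [sub_zero, norm_pow, Complex.norm_real, Real.norm_eq_abs, abs_of_nonneg (hp0 i)]
        have h1 : τ * Δ ≤ x i := mul_le_mul_of_nonneg_left (groundEnergy_add_gap_le hM hΔ i h) hτ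
        have h2 : p i ≤ Real.exp (-(τ * Δ / 2)) := by
          have := Real.add_one_le_exp (-(τ * Δ / 2))
          linarith [hple i]
        calc p i ^ r ≤ Real.exp (-(τ * Δ / 2)) ^ r := pow_le_pow_left₀ (hp0 i) h2 r
          _ = _ := by rw [← Real.exp_nat_mul]; congr 1; ring
  calc _ = ‖(T ^ r - groundProj M) + (S ^ r - T ^ r)‖ := by congr 1; abel
    _ ≤ _ := (norm_add_le _ _).trans (add_le_add hTP (norm_pow_sub_pow_le hT1 hST r))

end GroundProj

/-! ### From vector distance to total variation distance. -/

section TotalVariation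

variable {n : ℕ}

/-- Factor `|a ^ 2 - b ^ 2| = |a - b| * (a + b)` and apply Cauchy–Schwarz against each unit vector.
-/
theorem tvDist_distribution_le {ψ φ : StateSpace n} (hψ : ‖ψ‖ = 1) (hφ : ‖φ‖ = 1) :
    tvDist (distribution ψ) (distribution φ) ≤ ‖ψ - φ‖ := by
  have h1 : ∀ χ : StateSpace n, ∑ x, ‖ψ x - φ x‖ * ‖χ x‖ ≤ ‖ψ - φ‖ * ‖χ‖ := by
    intro χ
    rw [EuclideanSpace.norm_eq, EuclideanSpace.norm_eq χ]
    exact Real.sum_mul_le_sqrt_mul_sqrt _ _ _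
  have h2 : ∀ x, |distribution ψ x - distribution φ x| ≤
      ‖ψ x - φ x‖ * ‖ψ x‖ + ‖ψ x - φ x‖ * ‖φ x‖ := by
    intro x
    simp only [distribution]
    rw [sq_sub_sq, abs_mul, abs_of_nonneg (by positivity), ← mul_add, mul_comm]
    exact mul_le_mul_of_nonneg_right (abs_norm_sub_norm_le _ _) (by positivity)
  have h3 := Finset.sum_le_sum fun x (_ : x ∈ Finset.univ) => h2 x
  rw [Finset.sum_add_distrib] at h3
  have h4 := h1 ψ
  have h5 := h1 φ
  rw [hψ, mul_one] at h4
  rw [hφ, mul_one] at h5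
  unfold tvDist
  linarith

/-- The displacement of the vector and the mismatch of the two norms each cost at most `d / ‖v‖`. -/
theorem norm_normalize_sub_normalize_le {F : Type*} [NormedAddCommGroup F] [NormedSpace ℂ F]
    {u v : F} {d : ℝ} (hv : v ≠ 0) (hu : u ≠ 0) (h : ‖u - v‖ ≤ d) :
    ‖((‖v‖⁻¹ : ℝ) : ℂ) • v - ((‖u‖⁻¹ : ℝ) : ℂ) • u‖ ≤ 2 * d / ‖v‖ := by
  have hv' : 0 < ‖v‖ := norm_pos_iff.2 hv
  have hu' : 0 < ‖u‖ := norm_pos_iff.2 hu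
  have e : ((‖v‖⁻¹ : ℝ) : ℂ) • v - ((‖u‖⁻¹ : ℝ) : ℂ) • u =
      ((‖v‖⁻¹ : ℝ) : ℂ) • (v - u) + ((‖v‖⁻¹ - ‖u‖⁻¹ : ℝ) : ℂ) • u := by
    push_cast
    module
  have h1 : ‖((‖v‖⁻¹ - ‖u‖⁻¹ : ℝ) : ℂ) • u‖ = |‖u‖ - ‖v‖| / ‖v‖ := by
    rw [norm_smul, Complex.norm_real, Real.norm_eq_abs, ← abs_of_pos hu', ← abs_mul,
      abs_of_pos hu', sub_mul, inv_mul_cancel₀ hu'.ne', ← abs_of_pos hv', ← abs_div,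
      abs_of_pos hv']
    congr 1
    field_simp
  have h2 : ‖((‖v‖⁻¹ : ℝ) : ℂ) • (v - u)‖ = ‖u - v‖ / ‖v‖ := by
    rw [norm_smul, Complex.norm_real, Real.norm_eq_abs, abs_of_pos (inv_pos.2 hv'), norm_sub_rev]
    ring
  rw [e]
  refine (norm_add_le _ _).trans ?_
  rw [h1, h2, ← add_div]
  gcongr
  have := abs_norm_sub_norm_le u v
  linarith

theorem overlap_eq_norm (M : Operator n) : overlap M = ‖groundProj M (plus n)‖ := by
  have h : inner ℂ (plus n) (groundProj M (plus n)) =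
      inner ℂ (groundProj M (plus n)) (groundProj M (plus n)) := by
    unfold groundProj
    rw [Submodule.inner_starProjection_left_eq_right, ← mul_apply_eq_comp,
      (Submodule.isIdempotentElem_starProjection _).eq]
  have h2 : (inner ℂ (groundProj M (plus n)) (groundProj M (plus n))).re =
      ‖groundProj M (plus n)‖ ^ 2 := inner_self_eq_norm_sq (𝕜 := ℂ) _
  rw [overlap, h, h2, Real.sqrt_sq (norm_nonneg _)]

theorem norm_plus (n : ℕ) : ‖plus n‖ = 1 := by
  rw [EuclideanSpace.norm_eq, Real.sqrt_eq_one]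
  simp [plus]

theorem overlap_le_one (M : Operator n) : overlap M ≤ 1 := by
  rw [overlap_eq_norm, ← norm_plus n]
  exact Submodule.norm_starProjection_apply_le _ _

/-- The distribution of the ground state is approximated by that of a function which, as a state,
approximates the projection of the uniform superposition. -/
theorem tvDist_groundState_le {M : Operator n} {f : Bits n → ℝ} {c d : ℝ}
    (hη : 0 < overlap M) (hd : d < overlap M)
    (h : ‖(WithLp.toLp 2 fun x => ((c * f x : ℝ) : ℂ)) - groundProj M (plus n)‖ ≤ d) :
    (∑ y, f y ^ 2) ≠ 0 ∧
      tvDist (distribution (groundState M)) (fun x => f x ^ 2 / ∑ y, f y ^ 2) ≤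
        2 * d / overlap M := by
  set u : StateSpace n := WithLp.toLp 2 fun x => ((c * f x : ℝ) : ℂ)
  set v := groundProj M (plus n)
  have hηv : overlap M = ‖v‖ := overlap_eq_norm M
  have hv : v ≠ 0 := by rw [← norm_pos_iff, ← hηv]; exact hη
  have hu : u ≠ 0 := by
    rintro h0
    rw [h0, zero_sub, norm_neg, ← hηv] at h
    linarith
  have hnu : ‖u‖ ^ 2 = c ^ 2 * ∑ y, f y ^ 2 := by
    rw [EuclideanSpace.norm_eq, Real.sq_sqrt (by positivity), Finset.mul_sum]
    refine Finset.sum_congr rfl fun x _ => ?_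
    simp only [u]
    rw [Complex.norm_real, Real.norm_eq_abs, sq_abs, mul_pow]
  have hnu0 : c ^ 2 * ∑ y, f y ^ 2 ≠ 0 := by
    rw [← hnu]; exact pow_ne_zero _ (norm_ne_zero_iff.2 hu)
  refine ⟨right_ne_zero_of_mul hnu0, ?_⟩
  have hone : ∀ w : StateSpace n, w ≠ 0 → ‖((‖w‖⁻¹ : ℝ) : ℂ) • w‖ = 1 := by
    intro w hw
    rw [norm_smul, Complex.norm_real, Real.norm_eq_abs, abs_of_nonneg (by positivity)]
    exact inv_mul_cancel₀ (norm_ne_zero_iff.2 hw)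
  have hdist : distribution (((‖u‖⁻¹ : ℝ) : ℂ) • u) = fun x => f x ^ 2 / ∑ y, f y ^ 2 := by
    ext x
    simp only [distribution, PiLp.smul_apply, smul_eq_mul]
    rw [norm_mul, mul_pow, Complex.norm_real, Real.norm_eq_abs, sq_abs, inv_pow, hnu]
    simp only [u]
    rw [Complex.norm_real, Real.norm_eq_abs, sq_abs, mul_pow]
    have h0 := left_ne_zero_of_mul hnu0
    rw [mul_inv, ← mul_div_mul_left _ _ h0, div_eq_mul_inv, mul_inv]
    ring
  rw [← hdist, groundState, hηv]
  exact (tvDist_distribution_le (hone v hv) (hone u hu)).trans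
    (norm_normalize_sub_normalize_le hv hu h)

end TotalVariation

/-! ### Local real matrices, Taylor gates and positive perturbations. -/

section Embed

variable {n : ℕ}

/-- The operator on `n` qubits given by a real matrix on the qubits in `S`. -/
def embed (S : Finset (Fin n)) (B : Matrix (S → Bool) (S → Bool) ℝ) : Operator n := fun x y =>
  if ∀ i, i ∉ S → x i = y i then ((B (fun i => x i) (fun i => y i) : ℝ) : ℂ) else 0

theorem overwrite_restrict (S : Finset (Fin n)) (x : Bits n) (s : S → Bool) :
    (fun i : S => overwrite S x s i) = s := by
  ext i
  simp [overwrite]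

theorem overwrite_of_notMem {S : Finset (Fin n)} (x : Bits n) (s : S → Bool) {i : Fin n}
    (hi : i ∉ S) : overwrite S x s i = x i := by
  simp [overwrite, hi]

theorem overwrite_eq {S : Finset (Fin n)} {x y : Bits n} (h : ∀ i, i ∉ S → x i = y i) :
    overwrite S x (fun i => y i) = y := by
  ext i
  by_cases hi : i ∈ S
  · simp [overwrite, hi]
  · rw [overwrite_of_notMem _ _ hi, h i hi]

theorem sum_embed_mul (S : Finset (Fin n)) (B : Matrix (S → Bool) (S → Bool) ℝ) (x : Bits n)
    (F : Bits n → ℂ) :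
    ∑ y, embed S B x y * F y =
      ∑ s : S → Bool, ((B (fun i => x i) s : ℝ) : ℂ) * F (overwrite S x s) := by
  symm
  refine Fintype.sum_of_injective (overwrite S x) (fun s t h => ?_) _ _ (fun y hy => ?_)
    fun s => ?_
  · rw [← overwrite_restrict S x s, h, overwrite_restrict]
  · unfold embed
    rw [if_neg, zero_mul]
    exact fun h => hy ⟨_, overwrite_eq h⟩
  · unfold embed
    rw [if_pos fun i hi => (overwrite_of_notMem x s hi).symm, overwrite_restrict]

theorem embed_add (S : Finset (Fin n)) (B B' : Matrix (S → Bool) (S → Bool) ℝ) :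
    embed S (B + B') = embed S B + embed S B' := by
  ext x y
  simp only [embed, Matrix.add_apply]
  split_ifs <;> simp

theorem embed_smul (S : Finset (Fin n)) (c : ℝ) (B : Matrix (S → Bool) (S → Bool) ℝ) :
    embed S (c • B) = (c : ℂ) • embed S B := by
  ext x y
  simp only [embed, Matrix.smul_apply]
  split_ifs <;> simp

theorem embed_one (S : Finset (Fin n)) : embed S 1 = 1 := by
  ext x y
  simp only [embed, Matrix.one_apply]
  by_cases h : x = y
  · subst h; simp
  · rw [if_neg h]
    split_ifs with h1 h2
    · refine absurd ?_ h
      rw [← overwrite_eq h1, ← h2, overwrite_eq fun i _ => rfl]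
    · simp
    · rfl

theorem embed_mul (S : Finset (Fin n)) (B B' : Matrix (S → Bool) (S → Bool) ℝ) :
    embed S (B * B') = embed S B * embed S B' := by
  ext x z
  rw [Matrix.mul_apply, sum_embed_mul]
  simp only [embed, overwrite_restrict]
  have h : ∀ s : S → Bool, (∀ i, i ∉ S → overwrite S x s i = z i) ↔ ∀ i, i ∉ S → x i = z i :=
    fun s => forall₂_congr fun i hi => by rw [overwrite_of_notMem x s hi]
  simp only [h]
  split_ifs
  · rw [Matrix.mul_apply]; push_cast; rfl
  · simp

theorem Gate.embed_mulVec (g : Gate n) (f : Bits n → ℝ) (c : ℝ) :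
    (embed g.supp g.amp).mulVec (fun x => ((c * f x : ℝ) : ℂ)) =
      fun x => ((c * g.apply f x : ℝ) : ℂ) := by
  ext x
  rw [Matrix.mulVec, dotProduct, sum_embed_mul, Gate.apply, Finset.mul_sum]
  push_cast
  exact Finset.sum_congr rfl fun s _ => by ring

/-- Links the combinatorial gate action with operator products; the constant vector plays the role
of `|+⟩`. -/
theorem prod_embed_apply (gs : List (Gate n)) (c : ℝ) :
    (gs.map fun g => Matrix.toEuclideanCLM (𝕜 := ℂ) (embed g.supp g.amp)).prod
      (WithLp.toLp 2 fun _ => (c : ℂ)) =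
    WithLp.toLp 2 fun x => ((c * applyGates gs x : ℝ) : ℂ) := by
  induction gs with
  | nil => simp [applyGates]
  | cons g gs ih =>
    rw [List.map_cons, List.prod_cons, mul_apply_eq_comp, ih, Matrix.toEuclideanCLM_toLp,
      Gate.embed_mulVec]
    rfl

theorem norm_apply_le_opNorm (A : Operator n) (x y : Bits n) : ‖A x y‖ ≤ opNorm A := by
  have h := (Matrix.toEuclideanCLM (𝕜 := ℂ) A).le_opNorm (EuclideanSpace.single y 1)
  rw [PiLp.norm_single, norm_one, mul_one] at h
  refine le_trans ?_ h
  refine le_trans (le_of_eq ?_) (PiLp.norm_apply_le _ x)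
  rw [Matrix.ofLp_toEuclideanCLM]
  simp

/-- The gate of the quadratic Taylor polynomial of the exponential. -/
def taylorGate (S : Finset (Fin n)) (b : Matrix (S → Bool) (S → Bool) ℝ) : Gate n :=
  ⟨S, (1 / 2 : ℝ) • (1 + (1 + b) * (1 + b))⟩

theorem toEuclideanCLM_taylorGate (S : Finset (Fin n)) (b : Matrix (S → Bool) (S → Bool) ℝ) :
    Matrix.toEuclideanCLM (𝕜 := ℂ) (embed (taylorGate S b).supp (taylorGate S b).amp) =
      quadExp (Matrix.toEuclideanCLM (𝕜 := ℂ) (embed S b)) := by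
  simp only [taylorGate, embed_smul, embed_add, embed_mul, embed_one, map_smul, map_add, map_mul,
    map_one, quadExp]
  set X := Matrix.toEuclideanCLM (𝕜 := ℂ) (embed S b)
  rw [mul_add, mul_one, add_mul, one_mul]
  push_cast
  module

/-- Writing `1 + b + b ^ 2 / 2` as `(1 + (1 + b) ^ 2) / 2` reduces the claim to `1 + b`, whose
diagonal is nonnegative because entries of `b` are bounded by its norm. -/
theorem taylorGate_nonneg {S : Finset (Fin n)} {b : Matrix (S → Bool) (S → Bool) ℝ}
    (hoff : ∀ s t, s ≠ t → 0 ≤ b s t) (hnorm : opNorm (embed S b) ≤ 1) (s t : S → Bool) :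
    0 ≤ (taylorGate S b).amp s t := by
  have hb : ∀ s t, 0 ≤ (1 + b) s t := by
    intro s t
    by_cases h : s = t
    · subst h
      let x : Bits n := overwrite S (fun _ => false) s
      have h1 := (norm_apply_le_opNorm (embed S b) x x).trans hnorm
      rw [embed, if_pos fun _ _ => rfl, overwrite_restrict, Complex.norm_real,
        Real.norm_eq_abs] at h1
      rw [Matrix.add_apply, Matrix.one_apply_eq]
      linarith [(abs_le.1 h1).1]
    · rw [Matrix.add_apply, Matrix.one_apply_ne h, zero_add]
      exact hoff s t h
  show 0 ≤ (1 / 2 : ℝ) * ((1 : Matrix (S → Bool) (S → Bool) ℝ) s t + ((1 + b) * (1 + b)) s t)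
  have h1 : 0 ≤ (1 : Matrix (S → Bool) (S → Bool) ℝ) s t := by
    rw [Matrix.one_apply]; split_ifs <;> norm_num
  have h2 : 0 ≤ ((1 + b) * (1 + b)) s t := by
    rw [Matrix.mul_apply]
    exact Finset.sum_nonneg fun u _ => mul_nonneg (hb _ _) (hb _ _)
  linarith

/-- Add `δ` to every amplitude of a gate. -/
def Gate.shift (δ : ℝ) (g : Gate n) : Gate n := ⟨g.supp, Matrix.of fun s t => g.amp s t + δ⟩

theorem Gate.shift_zero (g : Gate n) : g.shift 0 = g := by
  cases g
  simp only [Gate.shift, add_zero]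
  rfl

theorem continuous_applyGates_shift (gs : List (Gate n)) (x : Bits n) :
    Continuous fun δ => applyGates (gs.map (Gate.shift δ)) x := by
  induction gs generalizing x with
  | nil => exact continuous_const
  | cons g gs ih =>
    show Continuous fun δ => ∑ s : g.supp → Bool, (g.amp (fun i => x i) s + δ) *
      applyGates (gs.map (Gate.shift δ)) (overwrite g.supp x s)
    exact continuous_finsetSum _ fun s _ => (continuous_const.add continuous_id).mul (ih _)

/-- Nonnegative gates can be replaced by positive ones with little effect. -/
theorem exists_shift_tvDist_le (gs : List (Gate n)) {q : Bits n → ℝ} {ε : ℝ}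
    (h0 : ∑ y, applyGates gs y ^ 2 ≠ 0)
    (h : tvDist q (fun x => applyGates gs x ^ 2 / ∑ y, applyGates gs y ^ 2) < ε) :
    ∃ δ : ℝ, 0 < δ ∧ tvDist q (fun x => applyGates (gs.map (Gate.shift δ)) x ^ 2 /
      ∑ y, applyGates (gs.map (Gate.shift δ)) y ^ 2) < ε := by
  have hz : gs.map (Gate.shift 0) = gs := by
    rw [List.map_congr_left fun g _ => Gate.shift_zero g, List.map_id']
  -- The amplitudes are continuous in `δ` and the normalization is nonzero at `0`, so the strict
  -- inequality survives for small `δ`. No size of `δ` is needed, as the number of gates does not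
  -- change.
  have hc : ContinuousAt (fun δ => tvDist q (fun x => applyGates (gs.map (Gate.shift δ)) x ^ 2 /
      ∑ y, applyGates (gs.map (Gate.shift δ)) y ^ 2)) 0 := by
    unfold tvDist
    refine continuousAt_const.mul (tendsto_finsetSum _ fun x _ => ?_)
    refine ContinuousAt.abs (continuousAt_const.sub (ContinuousAt.div ?_ ?_ ?_))
    · exact ((continuous_applyGates_shift gs x).pow 2).continuousAt
    · exact (continuous_finsetSum _ fun y _ =>
        (continuous_applyGates_shift gs y).pow 2).continuousAt
    · rwa [hz]
  have hev := hc.tendsto.eventually_lt_const (u := ε) (by simpa only [hz] using h)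
  obtain ⟨δ, h1, h2⟩ := ((hev.filter_mono nhdsWithin_le_nhds).and
    (self_mem_nhdsWithin (s := Set.Ioi (0 : ℝ)))).exists
  exact ⟨δ, h2, h1⟩

end Embed

/-! ### Trotterizing a local stoquastic Hamiltonian. -/

section Terms

variable {n L k : ℕ}

theorem LocalHamiltonian.isHermitian_total (H : LocalHamiltonian n L k) : H.total.IsHermitian := by
  unfold LocalHamiltonian.total Matrix.IsHermitian
  rw [Matrix.conjTranspose_sum]
  exact Finset.sum_congr rfl fun a _ => H.isHermitian a

theorem LocalHamiltonian.exists_embed {H : LocalHamiltonian n L k} (hH : H.IsStoquastic)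
    (a : Fin L) :
    ∃ (S : Finset (Fin n)) (B : Matrix (S → Bool) (S → Bool) ℝ), S.card ≤ k ∧
      H.term a = embed S B ∧ ∀ s t, s ≠ t → B s t ≤ 0 := by
  obtain ⟨S, hS, B, hB⟩ := H.isLocal a
  have hBe : ∀ s t, H.term a (overwrite S (fun _ => false) s) (overwrite S (fun _ => false) t) =
      B s t := by
    intro s t
    rw [hB, if_pos, overwrite_restrict, overwrite_restrict]
    intro i hi
    rw [overwrite_of_notMem _ _ hi, overwrite_of_notMem _ _ hi]
  have hne : ∀ s t : S → Bool, s ≠ t →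
      overwrite S (fun _ => false) s ≠ overwrite S (fun _ => false) t := by
    intro s t h h'
    exact h (by rw [← overwrite_restrict S (fun _ => false) s, h', overwrite_restrict])
  -- Off-diagonal entries are real by stoquasticity, diagonal ones by hermiticity.
  have him : ∀ s t, (B s t).im = 0 := by
    intro s t
    rw [← hBe]
    by_cases h : s = t
    · subst h
      have := (H.isHermitian a).apply (overwrite S (fun _ => false) s)
        (overwrite S (fun _ => false) s)
      exact Complex.conj_eq_iff_im.1 this
    · exact (hH a _ _ (hne s t h)).1
  refine ⟨S, B.map Complex.re, hS, ?_, fun s t h => ?_⟩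
  · ext x y
    rw [hB, embed]
    split_ifs
    · exact Complex.ext (by simp) (by simp [him])
    · rfl
  · show (B s t).re ≤ 0
    rw [← hBe]
    exact (hH a _ _ (hne s t h)).2

theorem opNorm_total_le {H : LocalHamiltonian n L k} {J : ℝ} (hJ : ∀ a, opNorm (H.term a) ≤ J) :
    opNorm H.total ≤ L * J := by
  unfold opNorm LocalHamiltonian.total
  rw [map_sum]
  calc _ ≤ ∑ a, opNorm (H.term a) := norm_sum_le _ _
    _ ≤ ∑ _ : Fin L, J := Finset.sum_le_sum fun a _ => hJ a
    _ = L * J := by simp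

theorem not_isEnergyGap_smul_one (c : ℂ) (Δ : ℝ) : ¬ IsEnergyGap (c • (1 : Operator n)) Δ := by
  intro h
  have hall : ∀ e ∈ energies (c • (1 : Operator n)), (e : ℂ) = c := by
    intro e he
    obtain ⟨ψ, h1, h2⟩ := mem_energies_iff.1 he
    rw [Matrix.smul_mulVec, Matrix.one_mulVec] at h2
    exact (smul_left_injective ℂ h1 h2).symm
  have h1 := hall _ h.1.1
  have hne : (energies (c • (1 : Operator n))).Nonempty := ⟨_, h.1.1⟩
  have h2 := hall _ (hne.csInf_mem (finite_energies _))
  exact h.1.2 (Complex.ofReal_injective (h1.trans h2.symm))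

/-- With no terms, or with only `0`-local terms, the total is a scalar operator, which has a single
energy. -/
theorem LocalHamiltonian.pos_of_isEnergyGap {H : LocalHamiltonian n L k} {Δ : ℝ}
    (h : IsEnergyGap H.total Δ) : 1 ≤ L ∧ 1 ≤ k := by
  constructor
  · by_contra hL
    obtain rfl : L = 0 := by omega
    refine not_isEnergyGap_smul_one (n := n) 0 Δ ?_
    rwa [zero_smul, show (0 : Operator n) = H.total by simp [LocalHamiltonian.total]]
  · by_contra hk
    obtain rfl : k = 0 := by omega
    have hc : ∀ a, ∃ c : ℂ, H.term a = c • 1 := by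
      intro a
      obtain ⟨S, hS, B, hB⟩ := H.isLocal a
      obtain rfl : S = ∅ := Finset.card_eq_zero.1 (by omega)
      refine ⟨B (fun i => absurd i.2 (Finset.notMem_empty _)) (fun i => absurd i.2 (Finset.notMem_empty _)), ?_⟩
      ext x y
      rw [hB, Matrix.smul_apply, Matrix.one_apply]
      by_cases hxy : x = y
      · subst hxy
        rw [if_pos fun _ _ => rfl, if_pos rfl, smul_eq_mul, mul_one]
        congr 1 <;> exact Subsingleton.elim _ _
      · rw [if_neg, if_neg hxy, smul_zero]
        exact fun h => hxy (funext fun i => h i (by simp))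
    choose c hc using hc
    refine not_isEnergyGap_smul_one (n := n) (∑ a, c a) Δ ?_
    rwa [Finset.sum_smul, ← Finset.sum_congr rfl fun a _ => hc a]

/-- A Trotter product of nonnegative local gates approximates the projection onto the ground
space. -/
theorem exists_gates {H : LocalHamiltonian n L k} (hH : H.IsStoquastic) {J Δ τ : ℝ}
    (hΔ : IsEnergyGap H.total Δ) (hJ : ∀ a, opNorm (H.term a) ≤ J) (hτ : 0 ≤ τ)
    (hσ : τ * (2 * L * J) ≤ 1) (r : ℕ) :
    ∃ gs : List (Gate n), (∀ g ∈ gs, g.supp.card ≤ k) ∧ (∀ g ∈ gs, ∀ s t, 0 ≤ g.amp s t) ∧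
      gs.length = r * (2 * L) ∧
      ∃ c : ℝ, ‖(WithLp.toLp 2 fun x => ((c * applyGates gs x : ℝ) : ℂ)) -
          groundProj H.total (plus n)‖ ≤
        Real.exp (-(r * (τ * Δ / 2))) + ((1 + (τ * (2 * L * J)) ^ 3) ^ r - 1) := by
  have hL : 1 ≤ L := (LocalHamiltonian.pos_of_isEnergyGap hΔ).1
  have hL0 : (L : ℂ) ≠ 0 := by exact_mod_cast (by omega : L ≠ 0)
  have hLr : (1 : ℝ) ≤ L := by exact_mod_cast hL
  have hM := H.isHermitian_total
  have hJ0 : 0 ≤ J := (norm_nonneg _).trans (hJ ⟨0, hL⟩)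
  set E := groundEnergy H.total with hEdef
  have hE : |E| ≤ L * J :=
    (abs_le_opNorm_of_mem_energies (isLeast_groundEnergy hM).1).trans (opNorm_total_le hJ)
  choose S B hS hB hoff using LocalHamiltonian.exists_embed hH
  -- The factor `τ / 2` reflects that each term occurs twice in the palindrome. The ground energy is
  -- subtracted in equal shares `E / L`, so the locality of each term is unchanged; the shares are
  -- at most `J` in size because `|E| ≤ L * J`.
  let b : ∀ a, Matrix (S a → Bool) (S a → Bool) ℝ := fun a =>
    (-(τ / 2)) • (B a + (-(E / L)) • 1)
  let X : Fin L → (StateSpace n →L[ℂ] StateSpace n) := fun a =>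
    Matrix.toEuclideanCLM (𝕜 := ℂ) (embed (S a) (b a))
  have hX : ∀ a, X a = (((-(τ / 2) : ℝ)) : ℂ) •
      (Matrix.toEuclideanCLM (𝕜 := ℂ) (H.term a) + ((-(E / L) : ℝ) : ℂ) • 1) := by
    intro a
    simp only [X, b, embed_smul, embed_add, embed_one, map_smul, map_add, map_one, ← hB]
  have hXn : ∀ a, ‖X a‖ ≤ τ * J := by
    intro a
    rw [hX, norm_smul, Complex.norm_real, Real.norm_eq_abs, abs_neg, abs_of_nonneg (by positivity)]
    have h1 : ‖((-(E / L) : ℝ) : ℂ) • (1 : StateSpace n →L[ℂ] StateSpace n)‖ ≤ J := by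
      rw [norm_smul, norm_one, mul_one, Complex.norm_real, Real.norm_eq_abs, abs_neg, abs_div,
        abs_of_nonneg (by positivity : (0 : ℝ) ≤ L), div_le_iff₀ (by positivity), mul_comm]
      exact hE
    calc τ / 2 * _ ≤ τ / 2 * (J + J) :=
          mul_le_mul_of_nonneg_left ((norm_add_le _ _).trans (add_le_add (hJ a) h1)) (by positivity)
      _ = τ * J := by ring
  let l := (List.finRange L).map X
  have hl : 2 * l.sum = -((τ : ℂ) • (Matrix.toEuclideanCLM (𝕜 := ℂ) H.total - (E : ℂ) • 1)) := by
    have h1 : l.sum = ∑ a, X a := by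
      rw [Fin.sum_univ_def]
    have h2 : Matrix.toEuclideanCLM (𝕜 := ℂ) H.total =
        ∑ a, Matrix.toEuclideanCLM (𝕜 := ℂ) (H.term a) := by
      rw [LocalHamiltonian.total, map_sum]
    rw [h1, h2, Finset.sum_congr rfl fun a _ => hX a, ← Finset.smul_sum, Finset.sum_add_distrib,
      Finset.sum_const, Finset.card_univ, Fintype.card_fin, ← Nat.cast_smul_eq_nsmul ℂ, smul_smul,
      two_mul]
    have h3 : (L : ℂ) * ((-(E / L) : ℝ) : ℂ) = -(E : ℂ) := by
      push_cast
      field_simp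
    rw [h3]
    push_cast
    module
  have hσ' : 2 * (l.map norm).sum ≤ τ * (2 * L * J) := by
    have h1 : (l.map norm).sum = ∑ a, ‖X a‖ := by
      rw [Fin.sum_univ_def, List.map_map]
      rfl
    rw [h1]
    calc 2 * ∑ a, ‖X a‖ ≤ 2 * ∑ _ : Fin L, τ * J := by
          gcongr with a
          exact hXn a
      _ = _ := by
          rw [Finset.sum_const, Finset.card_univ, Fintype.card_fin, nsmul_eq_mul]; ring
  have hmain := norm_palindrome_pow_sub_groundProj_le hM hΔ hτ l hl hσ' hσ r
  let G : Fin L → Gate n := fun a => taylorGate (S a) (b a)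
  let gs := (List.replicate r ((List.finRange L ++ (List.finRange L).reverse).map G)).flatten
  have hmem : ∀ g ∈ gs, ∃ a, g = G a := by
    intro g hg
    obtain ⟨l', hl', hg'⟩ := List.mem_flatten.1 hg
    rw [List.eq_of_mem_replicate hl'] at hg'
    obtain ⟨a, _, ha⟩ := List.mem_map.1 hg'
    exact ⟨a, ha.symm⟩
  -- The witness `1 / √(2 ^ n)` is the common amplitude of `|+⟩`.
  refine ⟨gs, fun g hg => ?_, fun g hg s t => ?_, ?_, 1 / √((2 : ℝ) ^ n), ?_⟩
  · obtain ⟨a, rfl⟩ := hmem g hg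
    exact hS a
  · obtain ⟨a, rfl⟩ := hmem g hg
    refine taylorGate_nonneg (fun s t hst => ?_) ?_ s t
    · show 0 ≤ (-(τ / 2)) * (B a s t + (-(E / L)) * (1 : Matrix _ _ ℝ) s t)
      rw [Matrix.one_apply_ne hst, mul_zero, add_zero]
      nlinarith [hoff a s t hst]
    · refine (hXn a).trans (le_trans ?_ hσ)
      have : 0 ≤ τ * J := mul_nonneg hτ hJ0
      nlinarith
  · simp only [gs, List.length_flatten, List.map_replicate, List.sum_replicate, List.length_map,
      List.length_append, List.length_reverse, List.length_finRange, smul_eq_mul]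
    ring
  · have hprod : (gs.map fun g => Matrix.toEuclideanCLM (𝕜 := ℂ) (embed g.supp g.amp)).prod =
        ((l ++ l.reverse).map quadExp).prod ^ r := by
      simp only [gs]
      rw [List.map_flatten, List.prod_flatten, List.map_replicate, List.map_replicate,
        List.prod_replicate, ← List.map_reverse, ← List.map_append, List.map_map, List.map_map]
      congr 3
      funext a
      exact toEuclideanCLM_taylorGate _ _
    rw [← prod_embed_apply, hprod]
    have h := (((l ++ l.reverse).map quadExp).prod ^ r - groundProj H.total).le_opNorm (plus n)
    rw [norm_plus, mul_one, sub_apply] at h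
    exact h.trans hmain

end Terms

/-! ### Parameter choices. -/

/-- The choice of the number of Trotter steps. -/
theorem exists_numSteps {w N : ℝ} (hN : 0 < N) (hN2 : N ≤ 1 / 2) (hw : 1 / 2 ≤ w) :
    ∃ r : ℕ, 1 ≤ r ∧ 20 * (Real.log N⁻¹ * w) ≤ r ∧
      Real.exp (-(5 * Real.log N⁻¹)) +
        ((1 + (20 * (Real.log N⁻¹ * w) / r) ^ 3) ^ r - 1) ≤ 3 * N / 16 ∧
      (r : ℝ) ≤ 2000 * ((Real.log N⁻¹ * w) ^ (3 / 2 : ℝ) * N ^ (-(1 / 2) : ℝ)) := by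
  have hlog : 1 / 2 ≤ Real.log N⁻¹ := by
    have h1 : Real.log 2 ≤ Real.log N⁻¹ := by
      apply Real.log_le_log (by norm_num)
      rw [le_inv_comm₀ (by norm_num) hN]
      linarith
    have := Real.log_two_gt_d9
    linarith
  set v := Real.log N⁻¹ * w with hv
  have hv4 : 1 / 4 ≤ v := by rw [hv]; nlinarith
  have hv0 : 0 < v := by linarith
  set y := 20 * v with hy
  have hy1 : 1 ≤ y := by linarith
  have hy0 : 0 < y := by linarith
  set D := y ^ (3 / 2 : ℝ) * N ^ (-(1 / 2) : ℝ) with hD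
  have hNi : 1 ≤ N ^ (-(1 / 2) : ℝ) :=
    Real.one_le_rpow_of_pos_of_le_one_of_nonpos hN (by linarith) (by norm_num)
  have hyy : y ≤ y ^ (3 / 2 : ℝ) := by
    conv_lhs => rw [← Real.rpow_one y]
    exact Real.rpow_le_rpow_of_exponent_le hy1 (by norm_num)
  have hDy : y ≤ D := by rw [hD]; nlinarith
  have hDsq : D ^ 2 = y ^ 3 / N := by
    rw [hD, mul_pow, ← Real.rpow_natCast, ← Real.rpow_natCast, ← Real.rpow_mul hy0.le,
      ← Real.rpow_mul hN.le]
    norm_num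
    rw [Real.rpow_neg_one, div_eq_mul_inv]
  -- The choice `r = ⌈4 * D⌉₊` with `D ^ 2 = y ^ 3 / N` makes the Trotter exponent `r * (y / r) ^ 3
  -- = y ^ 3 / r ^ 2` at most `N / 16`. The bound `|exp z - 1| ≤ 2 * z` then costs `N / 8`, and the
  -- filtering term `N ^ 5` another `N / 16`.
  have hr1 := Nat.le_ceil (4 * D)
  have hr2 := Nat.ceil_lt_add_one (by linarith : 0 ≤ 4 * D)
  set r := ⌈4 * D⌉₊
  have hr0 : (0 : ℝ) < r := by linarith
  have hyr : y ≤ r := by linarith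
  refine ⟨r, ?_, hyr, ?_, ?_⟩
  · exact_mod_cast hr0
  · have h1 : Real.exp (-(5 * Real.log N⁻¹)) = N ^ 5 := by
      rw [Real.log_inv, show -(5 * -Real.log N) = (5 : ℕ) * Real.log N by push_cast; ring,
        Real.exp_nat_mul, Real.exp_log hN]
    have h2 : N ^ 5 ≤ N / 16 := by
      have h3 : N ^ 4 ≤ (1 / 2) ^ 4 := pow_le_pow_left₀ hN.le hN2 4
      have h4 : N ^ 5 = N * N ^ 4 := by ring
      rw [h4]
      nlinarith
    have h3 : r * (y / r) ^ 3 ≤ N / 16 := by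
      have h4 : (4 * D) ^ 2 ≤ (r : ℝ) ^ 2 := pow_le_pow_left₀ (by linarith) hr1 2
      rw [mul_pow, hDsq, mul_div_assoc', div_le_iff₀ hN] at h4
      have h5 : r * (y / r) ^ 3 = y ^ 3 / r ^ 2 := by
        field_simp
      rw [h5, div_le_iff₀ (by positivity)]
      linarith
    have h4 : (1 + (y / r) ^ 3) ^ r ≤ Real.exp (r * (y / r) ^ 3) := by
      rw [Real.exp_nat_mul]
      refine pow_le_pow_left₀ (by positivity) ?_ r
      linarith [Real.add_one_le_exp ((y / r) ^ 3)]
    have h5 : 0 ≤ r * (y / r) ^ 3 := by positivity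
    have h6 := Real.abs_exp_sub_one_le (x := r * (y / r) ^ 3)
      (by rw [abs_of_nonneg h5]; linarith)
    rw [abs_of_nonneg h5] at h6
    have h7 := (le_abs_self _).trans h6
    rw [h1]
    linarith
  -- Since `1 ≤ y ≤ D`, `r ≤ 4 * D + 1 ≤ 5 * D`, and `20 ^ (3 / 2) ≤ 400` gives the constant `2000`.
  · have h1 : D ≤ 400 * (v ^ (3 / 2 : ℝ) * N ^ (-(1 / 2) : ℝ)) := by
      rw [hD, hy, Real.mul_rpow (by norm_num) hv0.le, mul_assoc]
      have h2 : (20 : ℝ) ^ (3 / 2 : ℝ) ≤ 20 ^ (2 : ℝ) :=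
        Real.rpow_le_rpow_of_exponent_le (by norm_num) (by norm_num)
      norm_num at h2
      exact mul_le_mul_of_nonneg_right h2 (by positivity)
    linarith

theorem qubitBound_eq {k L : ℕ} {J Δ η ε : ℝ} (hJ : 0 ≤ J) (hΔ : 0 < Δ) (hη : 0 < η)
    (hε : 0 < ε) (hlog : 0 ≤ Real.log (η * ε)⁻¹) :
    qubitBound k L J Δ η ε = k * L * ((Real.log (η * ε)⁻¹ * (L * J / Δ)) ^ (3 / 2 : ℝ) *
      (η * ε) ^ (-(1 / 2) : ℝ)) := by
  have hL : (L : ℝ) ^ (5 / 2 : ℝ) = L * (L : ℝ) ^ (3 / 2 : ℝ) := by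
    rw [show (5 / 2 : ℝ) = 1 + 3 / 2 by norm_num,
      Real.rpow_add_of_nonneg (Nat.cast_nonneg L) (by norm_num) (by norm_num), Real.rpow_one]
  rw [qubitBound, ← mul_inv, hL, Real.mul_rpow hlog (by positivity),
    Real.div_rpow (by positivity) hΔ.le, Real.mul_rpow (by positivity) hJ,
    Real.mul_rpow hη.le hε.le, Real.rpow_neg hΔ.le]
  ring

end Stoq

end

/-! ### Assembly of the main theorem. -/

theorem mainTheorem6 :
    ∃ C : ℝ, 0 < C ∧
      ∀ (n L k : ℕ) (H : Stoq.LocalHamiltonian n L k) (J Δ η ε : ℝ),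
        H.IsStoquastic →
        Stoq.IsEnergyGap H.total Δ →
        (∀ a, Stoq.opNorm (H.term a) ≤ J) →
        η = Stoq.overlap H.total →
        0 < η →
        0 < ε → ε ≤ 1 / 2 →
        ∃ (m : ℕ) (H' : Stoq.LocalHamiltonian (n + m) (n + m) (4 * k))
          (φ : Stoq.StateSpace (n + m)),
          H'.IsStoquastic ∧
          H'.IsFrustrationFree ∧
          (∀ j, ¬ Stoq.ActsOn (H'.term j) {j}ᶜ) ∧
          ‖φ‖ = 1 ∧
          Stoq.groundSpace H'.total = Submodule.span ℂ {φ} ∧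
          Stoq.tvDist (Stoq.distribution (Stoq.groundState H.total))
            (Stoq.marginal (Stoq.distribution φ)) ≤ ε ∧
          (m : ℝ) ≤ C * Stoq.qubitBound k L J Δ η ε ∧
          (n ≤ k * L → ((n + m : ℕ) : ℝ) ≤ C * Stoq.qubitBound k L J Δ η ε) := by
  -- The constant is `5 * 2000`: at most `4 * k * L * r` hidden qubits, up to `k * L * r` original
  -- ones, and `k * L * r` at most `2000` times the bound.
  refine ⟨10000, by norm_num, ?_⟩
  intro n L k H J Δ η ε hH hgap hJ hη hη0 hε hε2
  obtain ⟨hL, hk⟩ := Stoq.LocalHamiltonian.pos_of_isEnergyGap hgap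
  have hM := H.isHermitian_total
  have hΔ := Stoq.gap_pos hM hgap
  have hJ0 : 0 ≤ J := (norm_nonneg _).trans (hJ ⟨0, hL⟩)
  have hη1 : η ≤ 1 := hη ▸ Stoq.overlap_le_one _
  -- Both `E` and `E + Δ` lie in `[-(L * J), L * J]`, hence `Δ ≤ 2 * L * J`.
  have hw : 1 / 2 ≤ L * J / Δ := by
    rw [le_div_iff₀ hΔ]
    have h1 := (Stoq.abs_le_opNorm_of_mem_energies hgap.1.1).trans (Stoq.opNorm_total_le hJ)
    have h2 := (Stoq.abs_le_opNorm_of_mem_energies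
      (Stoq.isLeast_groundEnergy hM).1).trans (Stoq.opNorm_total_le hJ)
    linarith [(abs_le.1 h1).2, (abs_le.1 h2).1]
  have hN : 0 < η * ε := mul_pos hη0 hε
  have hN2 : η * ε ≤ 1 / 2 := by nlinarith
  have hlog : 0 ≤ Real.log (η * ε)⁻¹ :=
    Real.log_nonneg ((one_le_inv₀ hN).2 (by linarith))
  obtain ⟨r, hr1, hyr, herr, hrB⟩ := Stoq.exists_numSteps hN hN2 hw
  have hr0 : (0 : ℝ) < r := by exact_mod_cast hr1
  set l := Real.log (η * ε)⁻¹
  -- Chosen so that `r * (τ * Δ / 2) = 5 * l`.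
  set τ := 10 * l / Δ / r with hτ
  have hσ : τ * (2 * L * J) = 20 * (l * (L * J / Δ)) / r := by
    rw [hτ]; field_simp; ring
  obtain ⟨gs, hcard, hnn, hlen, c, hc⟩ := Stoq.exists_gates hH hgap hJ (τ := τ)
    (by positivity) (by rw [hσ]; exact (div_le_one hr0).2 hyr) r
  have hexp : (r : ℝ) * (τ * Δ / 2) = 5 * l := by
    rw [hτ]; field_simp; ring
  rw [hexp, hσ] at hc
  have hd := hc.trans herr
  have hdη : 3 * (η * ε) / 16 < Stoq.overlap H.total := by rw [← hη]; nlinarith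
  obtain ⟨h0, htv⟩ := Stoq.tvDist_groundState_le (hη ▸ hη0) hdη hd
  -- The left side is `3 * ε / 8`; the slack below `ε` pays for making the gates strictly positive.
  have hlt : 2 * (3 * (η * ε) / 16) / Stoq.overlap H.total < ε := by
    rw [← hη, div_lt_iff₀ hη0]; nlinarith
  obtain ⟨δ, hδ, htvδ⟩ := Stoq.exists_shift_tvDist_le gs h0 (htv.trans_lt hlt)
  obtain ⟨m, H', φ, h1, h2, h3, h4, h5, h6, hm⟩ := Stoq.exists_hamiltonian_of_gates hk
    (gs.map (Stoq.Gate.shift δ))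
    (fun g hg => by
      obtain ⟨g', hg', rfl⟩ := List.mem_map.1 hg
      exact hcard g' hg')
    (fun g hg s t => by
      obtain ⟨g', hg', rfl⟩ := List.mem_map.1 hg
      exact add_pos_of_nonneg_of_pos (hnn g' hg' s t) hδ)
  rw [List.length_map, hlen] at hm
  have hmr : (m : ℝ) ≤ 4 * (k * L * r) := by
    have : (m : ℝ) ≤ ((2 * (k * (r * (2 * L))) : ℕ) : ℝ) := by exact_mod_cast hm
    push_cast at this
    linarith
  have hB : (k * L * r : ℝ) ≤ 2000 * Stoq.qubitBound k L J Δ η ε := by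
    rw [Stoq.qubitBound_eq hJ0 hΔ hη0 hε hlog]
    calc (k * L * r : ℝ) ≤ k * L * _ := mul_le_mul_of_nonneg_left hrB (by positivity)
      _ = _ := by ring
  have hB0 : 0 ≤ (k * L * r : ℝ) := by positivity
  refine ⟨m, H', φ, h1, h2, h3, h4, h5, ?_, by linarith, fun hn => ?_⟩
  · rw [funext h6]
    exact htvδ.le
  · have hn' : (n : ℝ) ≤ k * L * r := by
      have : n ≤ k * L * r := hn.trans (Nat.le_mul_of_pos_right _ hr1)
      exact_mod_cast this
    push_cast
    linarith
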